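/- **Conventions.** Let $G$ be a finite or infinite countable group given by a presentation $G=\langle a_1,a_2,\dots \,\|\, R_1=1,R_2=1,\dots\rangle$ with a finite or countably infinite alphabet $\mathcal A=\{a_1,a_2,\dots\}$, and let $\mathcal X$ be a nonempty finite or countably infinite set of variables (for algorithmic statements, $\mathcal A$ and $\mathcal X$ are effectively numbered). An *equation* over $G$ is an expression $W=1$, where $W$ is a cyclically reduced word over $(\mathcal A\cup\mathcal X)^{\pm1}$ whose *length* $|W|_{\mathcal X}$, the number of occurrences of letters of $\mathcal X^{\pm1}$ in $W$, is positive. It is *quadratic* if every $x\in\mathcal X$ occurs in $W$, as $x$ or $x^{-1}$, exactly $2$ or $0$ times. It *has a solution* in $G$ if there is a homomorphism $\psi:G*F(\mathcal X)\to G$ with $\psi|_G=\mathrm{id}_G$ and $\psi(W)=1$. For a homomorphism $\mu:G\to H$, the equation $\mu(W)=1$ over $H$ is obtained by replacing each letter $a_j^{\pm1}$ of $W$ by $\mu(a_j)^{\pm1}$. If $H$ is generated by $h_1,h_2$ and $x_1,\dots,x_k$ are the variables occurring in $W$, a *solution tuple* of $\mu(W)=1$ is a tuple $(U_1,\dots,U_k)$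 of words in $h_1^{\pm1},h_2^{\pm1}$ such that some solution $\psi:H*F(\mathcal X)\to H$ of $\mu(W)=1$ has $\psi(x_j)=U_j$ in $H$ for all $j$; its length is $\sum_j|U_j|$. A presentation is *recursively enumerable* (*decidable*) if its set of defining words is recursively enumerable (recursive). **Theorem.** There is an absolute constant $C>0$ such that, for every integer $n\ge2$ and all $G$, $\mathcal X$ as above, the following holds. For every enumeration $W_1=1,W_2=1,\dots$ (repetitions allowed) of all quadratic equations over $G$ of length at most $n$ that have a solution in $G$, there are a group $H=\langle h_1,h_2\,\|\,S\rangle$ given by two generators and a set $S$ of defining words, and an injective homomorphism $\mu_n:G\to H$ such that every quadratic equation $W=1$ over $G$ of length at most $n$ has a solution in $G$ if and only if $\mu_n(W)=1$ has a solution in $H$, and (a) for every $i\ge1$ the equation $\mu_n(W_i)=1$ over $H$ has a solution tuple of length at most $C n^4 i$. If the enumeration is recursive, then $H$, $S$, $\mu_n$ can moreover be chosen so that also the following two properties hold. (b) If the given presentation of $G$ is recursively enumerable, then the set $S$ of defining words of $H$ is recursively enumerable. (c) If the given presentation of $G$ is decidable and there is an algorithm that detects whether a quadratic equation over $G$ of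 length at most $n$ has a solution in $G$, then the set $S$ of defining words of $H$ is decidable and $\mu_n$ is effective, i.e. there is an algorithm that computes for each $a_j$ a word in $h_1^{\pm1},h_2^{\pm1}$ representing $\mu_n(a_j)$. Finally, the enumeration can always be chosen so that it is recursive whenever the presentation of $G$ is recursively enumerable; in particular, for every $G$, $\mathcal X$ and $n$ there are an enumeration and an embedding $\mu_n$ as above for which (a), (b) and (c) hold simultaneously. -/

import Mathlib

namespace QuadEmb

/-- Words over `α^{±1}`; the letter `(a, true)` is `a` and `(a, false)` is `a⁻¹`. -/
abbrev Word (α : Type*) := List (α × Bool)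

/-- `⟨α ‖ w = 1, w ∈ R⟩` is a presentation of `G` in which the generator `a` is sent to `gen a`. -/
structure IsPresentation {α G : Type*} [Group G] (gen : α → G) (R : Set (Word α)) : Prop where
  surjective : Function.Surjective (FreeGroup.lift gen)
  ker_eq : (FreeGroup.lift gen).ker = Subgroup.normalClosure (FreeGroup.mk '' R)

/-- The group `⟨h₁, h₂ ‖ w = 1, w ∈ S⟩`. -/
abbrev TwoGenGroup (S : Set (Word (Fin 2))) : Type :=
  PresentedGroup (FreeGroup.mk '' S)

/-- The element of `⟨h₁, h₂ ‖ w = 1, w ∈ S⟩` represented by a word in `h₁, h₂`. -/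
def hval (S : Set (Word (Fin 2))) (w : Word (Fin 2)) : TwoGenGroup S :=
  PresentedGroup.mk (FreeGroup.mk '' S) (FreeGroup.mk w)

section Equations

variable {A X : Type*}

/-- The number of occurrences of letters of `X^{±1}`. -/
def xLength (W : Word (A ⊕ X)) : ℕ := W.countP fun l => l.1.isRight

open Classical in
/-- The number of occurrences of `x` plus the number of occurrences of `x⁻¹`. -/
noncomputable def occ (x : X) (W : Word (A ⊕ X)) : ℕ :=
  W.countP fun l => decide (l.1 = Sum.inr x)

open Classical in
/-- The set of variables that occur in `W` or in `W⁻¹`. -/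
noncomputable def vars (W : Word (A ⊕ X)) : Finset X :=
  (W.filterMap fun l => l.1.getRight?).toFinset

/-- `W = 1` is an equation: `W` is cyclically reduced and contains a variable. -/
def IsEquation (W : Word (A ⊕ X)) : Prop :=
  FreeGroup.IsCyclicallyReduced W ∧ 0 < xLength W

/-- `W = 1` is a quadratic equation. -/
def IsQuadratic (W : Word (A ⊕ X)) : Prop :=
  IsEquation W ∧ ∀ x : X, occ x W = 2 ∨ occ x W = 0

variable {K : Type*} [Group K]

/-- The element of the free product `K * F(X)` obtained from `W` when each coefficient letter `a`
is replaced by `c a`. -/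
def toCoprod (c : A → K) (W : Word (A ⊕ X)) : Monoid.Coprod K (FreeGroup X) :=
  FreeGroup.lift
    (Sum.elim (fun a => Monoid.Coprod.inl (c a)) (fun x => Monoid.Coprod.inr (FreeGroup.of x)))
    (FreeGroup.mk W)

/-- `ψ : K * F(X) → K` is a solution of `W = 1` over `K`, the coefficients being read through
`c : A → K`. -/
def IsSolution (c : A → K) (W : Word (A ⊕ X)) (ψ : Monoid.Coprod K (FreeGroup X) →* K) : Prop :=
  ψ.comp Monoid.Coprod.inl = MonoidHom.id K ∧ ψ (toCoprod c W) = 1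

/-- The equation `W = 1`, with coefficients read through `c : A → K`, has a solution in `K`.
For a homomorphism `μ : G → H` and coefficients `gen : A → G`, the equation `μ(W) = 1` over `H` is
the one with coefficients `fun a => μ (gen a)`. -/
def HasSolution (c : A → K) (W : Word (A ⊕ X)) : Prop :=
  ∃ ψ : Monoid.Coprod K (FreeGroup X) →* K, IsSolution c W ψ

/-- The family `(U x)`, `x` a variable of `W`, of words in `h₁, h₂` is a solution tuple of `W = 1`
over `⟨h₁, h₂ ‖ S⟩` (values of `U` at other variables are irrelevant). -/
def IsSolutionTuple (S : Set (Word (Fin 2))) (c : A → TwoGenGroup S) (W : Word (A ⊕ X))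
    (U : X → Word (Fin 2)) : Prop :=
  ∃ ψ : Monoid.Coprod (TwoGenGroup S) (FreeGroup X) →* TwoGenGroup S, IsSolution c W ψ ∧
    ∀ x ∈ vars W, ψ (Monoid.Coprod.inr (FreeGroup.of x)) = hval S (U x)

/-- The length of a solution tuple of `W = 1`. -/
noncomputable def tupleLength (W : Word (A ⊕ X)) (U : X → Word (Fin 2)) : ℕ :=
  ∑ x ∈ vars W, (U x).length

/-- `e 0, e 1, …` enumerates (possibly with repetitions) all quadratic equations over `K` of
length at most `n` that have a solution in `K`. -/
def IsEnumeration (n : ℕ) (c : A → K) (e : ℕ → Word (A ⊕ X)) : Prop :=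
  Set.range e = {W | IsQuadratic W ∧ xLength W ≤ n ∧ HasSolution c W}

/-- `μ` is an embedding that preserves solvability and unsolvability of the quadratic equations
of length at most `n` (in the variables `X`). -/
def PreservesQuadratic (X : Type*) {H : Type*} [Group H] (n : ℕ) (c : A → K) (μ : K →* H) : Prop :=
  Function.Injective μ ∧
    ∀ W : Word (A ⊕ X), IsQuadratic W → xLength W ≤ n →
      (HasSolution c W ↔ HasSolution (fun a => μ (c a)) W)

/-- The `i`-th equation (counted from `1`, so that `e i` is the equation number `i + 1`) has a
solution tuple of length at most `C n⁴ i` after applying `μ`. -/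
def HasShortSolutions (C : ℝ) (n : ℕ) (c : A → K) (e : ℕ → Word (A ⊕ X))
    (S : Set (Word (Fin 2))) (μ : K →* TwoGenGroup S) : Prop :=
  ∀ i : ℕ, ∃ U : X → Word (Fin 2), IsSolutionTuple S (fun a => μ (c a)) (e i) U ∧
    (tupleLength (e i) U : ℝ) ≤ C * (n : ℝ) ^ 4 * ((i : ℝ) + 1)

/-- There is an algorithm that detects whether a quadratic equation of length at most `n` has a
solution. -/
def DecidableQuadratic (X : Type*) [Primcodable A] [Primcodable X] (n : ℕ) (c : A → K) : Prop :=
  ∃ f : Word (A ⊕ X) → Bool, Computable f ∧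
    ∀ W, IsQuadratic W → xLength W ≤ n → (f W = true ↔ HasSolution c W)

/-- There is an algorithm that computes, for each generator `a`, a word in `h₁, h₂` representing
`μ(a)`. -/
def IsEffective [Primcodable A] (c : A → K) (S : Set (Word (Fin 2)))
    (μ : K →* TwoGenGroup S) : Prop :=
  ∃ m : A → Word (Fin 2), Computable m ∧ ∀ a, μ (c a) = hval S (m a)

end Equations

end QuadEmb

namespace QuadEmb

/-! Every generator of `G`, and every value of a variable in a chosen solution of a listed equation,
is coded by a positive word `w_i = ∏_{k < N} h₁ h₂^{N i + k + 1}`. The defining words of `H` say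
only that the code words satisfy the relations of `G` and the listed equations, so these equations
have code words as solution tuples, of explicit length. With `b_i` the element coded by `w_i`, `H`
maps to `Q = (G * F(h₁, h₂)) / ⟨⟨b_i⁻¹ w_i⟩⟩` compatibly with `G`. What remains is
`exists_solution_of_mem_normalClosure`: a quadratic equation over `G` with few variables that is
solvable in `Q` is solvable in `G`. The case without variables gives injectivity.

A solution in `Q` is an identity `W(x) · ∏ z_s r_s^{±1} z_s⁻¹ = 1` in `G * F(h₁, h₂)` with `m`
relators `r_s`. It is quadratic in `x` and `z`, so following cancellations through the two copies of
each variable pairs off the letters of the relators (`exists_matching`); geometrically, the relator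
discs are glued along edges to a surface. If two paired letters stand in the same place of equal
code words, changing the value on their arc kills both relators and keeps the others
(`exists_cancelled`), and `m` drops.

Otherwise all exponents `N i + k + 1` being distinct prevents a block from being glued onto a whole
block, so each of the `N m` blocks meets a vertex of degree at least `3` (`Letter.mul_card_le`). An
Euler characteristic count then gives `N m ≤ 6 (v + m)`, where `v` counts the variables `x` and `z`
(`mul_card_le_of_matching`), which is false for the chosen `N`. The topology is replaced by linear
algebra modulo `2`: evaluating the identity in a Heisenberg group computes intersection numbers and
gives `edges ≤ vertices + relators + variables`.

For the effectivity, code words are primitive recursive and longer than their indices, so membership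
in `S` is a bounded search; solvable equations are enumerated through finite certificates
(`exists_isEnumeration`). -/

/-- The value of a word under an assignment of group elements to letters. -/
def wordEval {α K : Type*} [Group K] (f : α → K) (L : Word α) : K :=
  FreeGroup.lift f (FreeGroup.mk L)

/-! ### Evaluation of words and substitution -/

section WordEval

variable {α β K K' : Type*} [Group K] [Group K']

@[simp]
theorem wordEval_nil (f : α → K) : wordEval f [] = 1 := by simp [wordEval]

theorem wordEval_cons (f : α → K) (a : α × Bool) (L : Word α) :
    wordEval f (a :: L) = cond a.2 (f a.1) (f a.1)⁻¹ * wordEval f L := by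
  simp [wordEval]

theorem wordEval_append (f : α → K) (L M : Word α) :
    wordEval f (L ++ M) = wordEval f L * wordEval f M := by
  simp [wordEval]

theorem wordEval_invRev (f : α → K) (L : Word α) :
    wordEval f (FreeGroup.invRev L) = (wordEval f L)⁻¹ := by
  rw [wordEval, wordEval, ← FreeGroup.inv_mk, map_inv]

theorem map_wordEval (φ : K →* K') (f : α → K) (L : Word α) :
    φ (wordEval f L) = wordEval (fun a => φ (f a)) L := by
  induction L with
  | nil => simp
  | cons a L ih => rcases a with ⟨a, _ | _⟩ <;> simp [wordEval_cons, ih]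

theorem wordEval_map (f : β → K) (g : α → β) (L : Word α) :
    wordEval f (L.map fun a => (g a.1, a.2)) = wordEval (fun a => f (g a)) L := by
  induction L with
  | nil => simp
  | cons a L ih => simp [wordEval_cons, ih]

theorem wordEval_congr {f g : α → K} {L : Word α} (h : ∀ a ∈ L, f a.1 = g a.1) :
    wordEval f L = wordEval g L := by
  induction L with
  | nil => simp
  | cons a L ih =>
    rw [wordEval_cons, wordEval_cons, h a (by simp), ih fun b hb => h b (by simp [hb])]

theorem wordEval_of (L : Word α) : wordEval FreeGroup.of L = FreeGroup.mk L := by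
  rw [wordEval, FreeGroup.lift_of_eq_id, MonoidHom.id_apply]

/-- Replace every letter `a` by the word `s a`, and `a⁻¹` by the inverse word. -/
def subst (s : α → Word β) (L : Word α) : Word β :=
  L.flatMap fun a => cond a.2 (s a.1) (FreeGroup.invRev (s a.1))

@[simp]
theorem subst_nil (s : α → Word β) : subst s [] = [] := rfl

theorem subst_cons (s : α → Word β) (a : α × Bool) (L : Word α) :
    subst s (a :: L) = cond a.2 (s a.1) (FreeGroup.invRev (s a.1)) ++ subst s L := rfl

theorem wordEval_subst (f : β → K) (s : α → Word β) (L : Word α) :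
    wordEval f (subst s L) = wordEval (fun a => wordEval f (s a)) L := by
  induction L with
  | nil => simp
  | cons a L ih =>
    rcases a with ⟨a, _ | _⟩ <;>
      simp [subst_cons, wordEval_cons, wordEval_append, wordEval_invRev, ih]

end WordEval

/-! ### Cancellation patterns in words -/

/-- `Paired L P`: the letters of `L` can be cancelled successively, a letter `y^ε` against an
adjacent letter `y'^{-ε}`, the list of the pairs `(y, y')` being `P`. -/
inductive Paired {Y : Type*} : Word Y → List (Y × Y) → Prop
  | nil : Paired [] []
  | step {L M : Word Y} {P : List (Y × Y)} (y y' : Y) (ε : Bool) (h : Paired (L ++ M) P) :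
      Paired (L ++ (y, ε) :: (y', !ε) :: M) ((y, y') :: P)

namespace Paired

variable {Y Lab K : Type*} [Group K]

theorem wordEval_eq_one {L : Word Y} {P : List (Y × Y)} (h : Paired L P) (f : Y → K)
    (hf : ∀ p ∈ P, f p.1 = f p.2) : wordEval f L = 1 := by
  induction h with
  | nil => simp
  | step y y' ε _ ih =>
    have h1 := ih fun p hp => hf p (by simp [hp])
    have h2 : f y = f y' := hf (y, y') (by simp)
    rw [wordEval_append] at h1 ⊢
    cases ε <;> simp [wordEval_cons, h2, h1]

theorem perm {L : Word Y} {P : List (Y × Y)} (h : Paired L P) :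
    (L.map Prod.fst).Perm (P.flatMap fun p => [p.1, p.2]) := by
  induction h with
  | nil => simp
  | @step L M P y y' ε _ ih =>
    simp only [List.map_append, List.map_cons, List.flatMap_cons] at ih ⊢
    refine List.Perm.trans (List.perm_append_comm_assoc _ [y, y'] _) ?_
    exact List.Perm.append_left [y, y'] ih

/-- A reduction of the labelled word to the empty word lifts step by step to the unlabelled letters;
each step contributes one pair. -/
theorem exists_of_mk_eq_one (ℓ : Y → Lab) (L : Word Y)
    (h : FreeGroup.mk (L.map fun a => (ℓ a.1, a.2)) = 1) :
    ∃ P, Paired L P ∧ ∀ p ∈ P, ℓ p.1 = ℓ p.2 := by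
  rw [FreeGroup.one_eq_mk, FreeGroup.Red.exact] at h
  obtain ⟨M, h1, h2⟩ := h
  rw [FreeGroup.Red.nil_iff] at h2
  subst h2
  generalize hL : (L.map fun a => (ℓ a.1, a.2)) = L' at h1
  induction h1 using Relation.ReflTransGen.head_induction_on generalizing L with
  | refl =>
    rw [List.map_eq_nil_iff] at hL
    subst hL
    exact ⟨[], .nil, by simp⟩
  | head hs _ ih =>
    obtain ⟨⟩ := hs
    rw [List.map_eq_append_iff] at hL
    obtain ⟨L₁, L₂, rfl, rfl, hL⟩ := hL
    rw [List.map_eq_cons_iff] at hL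
    obtain ⟨a, L₃, rfl, ha, hL⟩ := hL
    rw [List.map_eq_cons_iff] at hL
    obtain ⟨a', L₄, rfl, ha', rfl⟩ := hL
    obtain ⟨P, hP, hP'⟩ := ih (L₁ ++ L₄) (by simp)
    obtain ⟨y, ε⟩ := a
    obtain ⟨y', ε'⟩ := a'
    simp only [Prod.mk.injEq] at ha ha'
    obtain ⟨rfl, rfl⟩ := ha
    obtain ⟨h1, rfl⟩ := ha'
    refine ⟨(y, y') :: P, .step y y' _ hP, ?_⟩
    intro p hp
    rcases List.mem_cons.1 hp with rfl | hp
    · exact h1.symm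
    · exact hP' p hp

end Paired

/-! ### Triviality in the free product of `G` with a free group -/

section FreeProduct

variable {G Y Lab K : Type*} [Group G] [Group K]

/-- The letters `y` of a word over `G ⊔ Y`, each recorded with the product of the coefficients that
precede it (starting from `g`). -/
def unfold : G → Word (G ⊕ Y) → Word (G × Y)
  | _, [] => []
  | g, (Sum.inl a, ε) :: L => unfold (g * cond ε a a⁻¹) L
  | g, (Sum.inr y, ε) :: L => ((g, y), ε) :: unfold g L

/-- Pushing all coefficients to the right turns each remaining letter into its conjugate by the
coefficients met before it. -/
theorem mul_wordEval_eq (c : G →* K) (f : Y → K) (g : G) (L : Word (G ⊕ Y)) :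
    c g * wordEval (Sum.elim c f) L =
      wordEval (fun p : G × Y => c p.1 * f p.2 * (c p.1)⁻¹) (unfold g L) *
        c (g * wordEval (Sum.elim id fun _ => 1) L) := by
  induction L generalizing g with
  | nil => simp [unfold]
  | cons a L ih =>
    obtain ⟨a | y, ε⟩ := a
    · have := ih (g * cond ε a a⁻¹)
      rw [unfold, wordEval_cons, wordEval_cons]
      cases ε <;> simpa [mul_assoc] using this
    · have := ih g
      rw [unfold, wordEval_cons, wordEval_cons, wordEval_cons]
      have h : ∀ t : K, c g * (t * wordEval (Sum.elim (⇑c) f) L) =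
          c g * t * (c g)⁻¹ * (c g * wordEval (Sum.elim (⇑c) f) L) := by
        intro t; group
      dsimp only
      rw [h, this]
      cases ε <;> simp [mul_assoc]

theorem unfold_map (ℓ : Y → Lab) (g : G) (L : Word (G ⊕ Y)) :
    unfold g (L.map fun a => (Sum.map id ℓ a.1, a.2)) =
      (unfold g L).map fun a => ((a.1.1, ℓ a.1.2), a.2) := by
  induction L generalizing g with
  | nil => simp [unfold]
  | cons a L ih => obtain ⟨a | y, ε⟩ := a <;> simp [unfold, ih]

theorem unfold_map_snd (g : G) (L : Word (G ⊕ Y)) :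
    (unfold g L).map (fun a => a.1.2) = L.filterMap fun a => a.1.getRight? := by
  induction L generalizing g with
  | nil => simp [unfold]
  | cons a L ih => obtain ⟨a | y, ε⟩ := a <;> simp [unfold, ih, List.filterMap_cons]

/-- `G` acts on the free group over `G × Lab` by left translation of the first coordinate. -/
def translate (G Lab : Type*) [Group G] : G →* MulAut (FreeGroup (G × Lab)) where
  toFun g := FreeGroup.freeGroupCongr ((Equiv.mulLeft g).prodCongr (Equiv.refl Lab))
  map_one' := by
    ext x
    induction x using FreeGroup.induction_on <;> simp_all
  map_mul' g h := by
    ext x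
    induction x using FreeGroup.induction_on <;> simp_all [mul_assoc, Prod.map]

/-- The free product of `G` with a free group. -/
abbrev FP (G Lab : Type*) [Group G] := Monoid.Coprod G (FreeGroup Lab)

/-- The assignment of the letters of `G ⊔ Lab` to the obvious elements of the free product. -/
def fpLetter : G ⊕ Lab → FP G Lab :=
  Sum.elim (Monoid.Coprod.inl : G →* FP G Lab) fun k => Monoid.Coprod.inr (FreeGroup.of k)

theorem exists_word (p : FP G Lab) : ∃ L : Word (G ⊕ Lab), wordEval fpLetter L = p := by
  induction p using Monoid.Coprod.induction_on with
  | inl g => exact ⟨[(Sum.inl g, true)], by simp [wordEval_cons, fpLetter]⟩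
  | inr x =>
    induction x using FreeGroup.induction_on with
    | C1 => exact ⟨[], by simp⟩
    | of a => exact ⟨[(Sum.inr a, true)], by simp [wordEval_cons, fpLetter]⟩
    | inv_of a _ => exact ⟨[(Sum.inr a, false)], by simp [wordEval_cons, fpLetter]⟩
    | mul x y hx hy =>
      obtain ⟨L, hL⟩ := hx
      obtain ⟨M, hM⟩ := hy
      exact ⟨L ++ M, by simp [wordEval_append, hL, hM]⟩
  | mul x y hx hy =>
    obtain ⟨L, rfl⟩ := hx
    obtain ⟨M, rfl⟩ := hy
    exact ⟨L ++ M, by simp [wordEval_append]⟩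

/-- `G * F(Lab)` maps to `F(G × Lab) ⋊ G`, where the conjugate of `k` by `g` becomes the free
generator `(g, k)`. The two components of the image of `L` are the two claims. -/
theorem unfold_eq_one_of_wordEval_eq_one {L : Word (G ⊕ Lab)} (h : wordEval fpLetter L = 1) :
    FreeGroup.mk (unfold 1 L) = 1 ∧ wordEval (Sum.elim id fun _ => 1) L = (1 : G) := by
  let φ : FP G Lab →* FreeGroup (G × Lab) ⋊[translate G Lab] G :=
    Monoid.Coprod.lift SemidirectProduct.inr
      (FreeGroup.lift fun k => SemidirectProduct.inl (FreeGroup.of (1, k)))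
  have h1 : wordEval (Sum.elim (SemidirectProduct.inr :
      G →* FreeGroup (G × Lab) ⋊[translate G Lab] G)
      fun k => SemidirectProduct.inl (FreeGroup.of ((1 : G), k))) L = 1 := by
    rw [← map_one φ, ← h, map_wordEval]
    congr 1
    ext1 (g | k) <;> simp [fpLetter, φ]
  have h2 := mul_wordEval_eq (SemidirectProduct.inr :
    G →* FreeGroup (G × Lab) ⋊[translate G Lab] G)
    (fun k => SemidirectProduct.inl (FreeGroup.of ((1 : G), k))) 1 L
  have h3 : (fun p : G × Lab => (SemidirectProduct.inr p.1 *
      SemidirectProduct.inl (FreeGroup.of ((1 : G), p.2)) * (SemidirectProduct.inr p.1)⁻¹ :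
        FreeGroup (G × Lab) ⋊[translate G Lab] G)) =
      fun p => SemidirectProduct.inl (FreeGroup.of p) := by
    ext1 p
    rw [← map_inv, ← SemidirectProduct.inl_aut]
    simp [translate]
  rw [h1, h3, ← map_wordEval, wordEval_of] at h2
  constructor
  · simpa using (congrArg SemidirectProduct.left h2).symm
  · simpa using (congrArg SemidirectProduct.right h2).symm

/-- If the word obtained from `L` by the relabelling `ℓ` is trivial in `G * F(Lab)`, then the letters
of `L` outside `G` can be paired, with equal labels, in such a way that `L` is trivial under every
assignment that agrees on the pairs. -/
theorem exists_pairing (ℓ : Y → Lab) (L : Word (G ⊕ Y))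
    (h : wordEval (fun a => fpLetter (Sum.map id ℓ a)) L = 1) :
    ∃ P : List ((G × Y) × (G × Y)), Paired (unfold 1 L) P ∧
      (∀ p ∈ P, p.1.1 = p.2.1 ∧ ℓ p.1.2 = ℓ p.2.2) ∧
      wordEval (Sum.elim id fun _ => 1) L = (1 : G) := by
  have h0 := h
  rw [← wordEval_map] at h0
  obtain ⟨h1, h2⟩ := unfold_eq_one_of_wordEval_eq_one h0
  rw [unfold_map] at h1
  obtain ⟨P, hP, hP'⟩ := Paired.exists_of_mk_eq_one
    (fun a : G × Y => (a.1, ℓ a.2)) _ h1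
  refine ⟨P, hP, fun p hp => by simpa using hP' p hp, ?_⟩
  rw [wordEval_map] at h2
  refine Eq.trans ?_ h2
  congr 1
  ext1 (g | k) <;> simp

/-- The point of a pairing: it is a cancellation scheme valid in any group, so a solution may be
altered freely as long as paired letters keep equal values. -/
theorem wordEval_eq_one_of_pairing {L : Word (G ⊕ Y)} {P : List ((G × Y) × (G × Y))}
    (hP : Paired (unfold 1 L) P) (hP₁ : ∀ p ∈ P, p.1.1 = p.2.1)
    (hL : wordEval (Sum.elim id fun _ => 1) L = (1 : G)) (c : G →* K) (f : Y → K)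
    (hf : ∀ p ∈ P, f p.1.2 = f p.2.2) : wordEval (Sum.elim c f) L = 1 := by
  have h := mul_wordEval_eq c f 1 L
  rw [hL, hP.wordEval_eq_one _ fun p hp => by rw [hP₁ p hp, hf p hp]] at h
  simpa using h

end FreeProduct

/-! ### Matching the end points of arcs -/

section Arcs

variable {Y Lab : Type*} [DecidableEq Y]

/-- The number of occurrences of `y` in the pairs of a list. -/
def pairCount (P : List (Y × Y)) (y : Y) : ℕ := (P.flatMap fun p => [p.1, p.2]).count y

theorem pairCount_cons (p : Y × Y) (P : List (Y × Y)) (y : Y) :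
    pairCount (p :: P) y =
      pairCount P y + (if p.1 = y then 1 else 0) + (if p.2 = y then 1 else 0) := by
  simp only [pairCount, List.flatMap_cons, List.count_append, List.count_cons, List.count_nil,
    beq_iff_eq]
  omega

/-- In a multigraph with all degrees at most `2`, given by the list of its edges, the vertices of
degree `1` are matched by the relation of lying in the same component. -/
theorem exists_arcs (ℓ : Y → Lab) (P : List (Y × Y)) (hℓ : ∀ p ∈ P, ℓ p.1 = ℓ p.2)
    (hc : ∀ y, pairCount P y ≤ 2) :
    ∃ q : Y → Y, (∀ p ∈ P, q p.1 = q p.2) ∧ (∀ u v, q u = q v → ℓ u = ℓ v) ∧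
      (∀ u v, pairCount P u = 0 → q u = q v → u = v) ∧
      ∀ u, pairCount P u = 1 → ∃ v, v ≠ u ∧ pairCount P v = 1 ∧ q v = q u ∧
        ∀ v', pairCount P v' = 1 → q v' = q u → v' = u ∨ v' = v := by
  induction P with
  | nil => exact ⟨id, by simp, by simp, by simp, by simp [pairCount]⟩
  | cons p P ih =>
    obtain ⟨y, y'⟩ := p
    have hcount := pairCount_cons (y, y') P
    simp only at hcount
    obtain ⟨q, h1, h2, h3, h4⟩ := ih (fun p hp => hℓ p (by simp [hp])) fun u => by
      have := hc u
      rw [hcount] at this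
      omega
    have hy : ℓ y = ℓ y' := hℓ (y, y') (by simp)
    have hcy := hc y
    have hcy' := hc y'
    rw [hcount] at hcy hcy'
    simp only [hcount]
    by_cases hyy : y = y'
    · subst hyy
      refine ⟨q, ?_, h2, ?_, ?_⟩
      · intro p hp
        rcases List.mem_cons.1 hp with rfl | hp
        · rfl
        · exact h1 p hp
      · grind
      · intro u hu
        obtain ⟨v, hv⟩ := h4 u (by grind)
        exact ⟨v, by grind⟩
    -- The new edge merges the component of `y'` into that of `y`.
    · refine ⟨fun u => if q u = q y' then q y else q u, ?_, ?_, ?_, ?_⟩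
      · intro p hp
        rcases List.mem_cons.1 hp with rfl | hp
        · simp
        · simp only [h1 p hp]
      · intro u v huv
        grind
      · intro u v hu huv
        grind
      · intro u hu
        by_cases hu1 : u = y
        · subst hu1
          by_cases hy1 : pairCount P y' = 1
          · obtain ⟨v, hv⟩ := h4 y' hy1
            exact ⟨v, by grind⟩
          · exact ⟨y', by grind⟩
        by_cases hu2 : u = y'
        · subst hu2
          by_cases hy1 : pairCount P y = 1
          · obtain ⟨v, hv⟩ := h4 y hy1
            exact ⟨v, by grind⟩
          · exact ⟨y, by grind⟩
        obtain ⟨v, hv, hv1, hv2, hv3⟩ := h4 u (by grind)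
        by_cases hvy : v = y
        · subst hvy
          by_cases hy1 : pairCount P y' = 1
          · obtain ⟨v', hv'⟩ := h4 y' hy1
            exact ⟨v', by grind⟩
          · exact ⟨y', by grind⟩
        by_cases hvy' : v = y'
        · subst hvy'
          by_cases hy1 : pairCount P y = 1
          · obtain ⟨v', hv'⟩ := h4 y hy1
            exact ⟨v', by grind⟩
          · exact ⟨y, by grind⟩
        exact ⟨v, by grind⟩

end Arcs

/-! ### The Heisenberg group modulo 2 -/

/-- The Heisenberg group over the field with two elements. -/
@[ext]
structure Heis where
  /-- the entry in position `(1, 2)` -/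
  x : ZMod 2
  /-- the entry in position `(2, 3)` -/
  y : ZMod 2
  /-- the entry in position `(1, 3)` -/
  z : ZMod 2

namespace Heis

instance : Mul Heis := ⟨fun a b => ⟨a.x + b.x, a.y + b.y, a.z + b.z + a.x * b.y⟩⟩
instance : One Heis := ⟨⟨0, 0, 0⟩⟩
instance : Inv Heis := ⟨fun a => ⟨-a.x, -a.y, -a.z + a.x * a.y⟩⟩

@[simp] theorem mul_x (a b : Heis) : (a * b).x = a.x + b.x := rfl
@[simp] theorem mul_y (a b : Heis) : (a * b).y = a.y + b.y := rfl
@[simp] theorem mul_z (a b : Heis) : (a * b).z = a.z + b.z + a.x * b.y := rfl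
@[simp] theorem one_x : (1 : Heis).x = 0 := rfl
@[simp] theorem one_y : (1 : Heis).y = 0 := rfl
@[simp] theorem one_z : (1 : Heis).z = 0 := rfl
@[simp] theorem inv_x (a : Heis) : (a⁻¹).x = -a.x := rfl
@[simp] theorem inv_y (a : Heis) : (a⁻¹).y = -a.y := rfl
@[simp] theorem inv_z (a : Heis) : (a⁻¹).z = -a.z + a.x * a.y := rfl

instance : Group Heis := Group.ofLeftAxioms
  (fun a b c => by ext <;> simp <;> ring)
  (fun a => by ext <;> simp)
  (fun a => by
    ext
    · exact neg_add_cancel a.x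
    · exact neg_add_cancel a.y
    · change -a.z + a.x * a.y + a.z + -a.x * a.y = 0
      ring)

theorem wordEval_x {α : Type*} (f : α → Heis) (L : Word α) :
    (wordEval f L).x = (L.map fun a => (f a.1).x).sum := by
  induction L with
  | nil => simp
  | cons a L ih => rcases a with ⟨a, _ | _⟩ <;> simp [wordEval_cons, ih, ZMod.neg_eq_self_mod_two]

/-- On elements whose first coordinate vanishes the third coordinate is additive. -/
theorem wordEval_z {α : Type*} (f : α → Heis) (L : Word α) (h : ∀ a ∈ L, (f a.1).x = 0) :
    (wordEval f L).z = (L.map fun a => (f a.1).z).sum := by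
  induction L with
  | nil => simp
  | cons a L ih =>
    have h1 := h a (by simp)
    have h2 := ih fun b hb => h b (by simp [hb])
    rcases a with ⟨a, _ | _⟩ <;> simp_all [wordEval_cons, ZMod.neg_eq_self_mod_two]

end Heis

/-! ### Counting vertices of the glued surface -/

section Orbits

variable {Λ : Type*} [Fintype Λ] [DecidableEq Λ]

/-- The classes of the equivalence relation generated by `c ~ τ c` and `σ c ~ σ (τ c)`. -/
def turnSetoid (τ σ : Λ → Λ) : Setoid Λ :=
  Relation.EqvGen.setoid fun a b => b = τ a ∨ ∃ c, a = σ c ∧ b = σ (τ c)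

-- Letters stand for their starting vertices, and the classes are the vertices after gluing. A class
-- has at least two letters, and at least three if a turn `τ (σ c) ≠ σ (τ c)` occurs at it. With `t`
-- turns at a class of size `o` one has `t ≤ o`, hence `t + 6 ≤ 3 o` in both cases.
open Classical in
theorem card_turn_le (τ σ : Λ → Λ) (hτ : ∀ c, τ c ≠ c) (hσ : Function.Bijective σ) :
    (Finset.univ.filter fun c => τ (σ c) ≠ σ (τ c)).card +
      6 * Fintype.card (Quotient (turnSetoid τ σ)) ≤ 3 * Fintype.card Λ := by
  set Q := Quotient (turnSetoid τ σ)
  let π : Λ → Q := Quotient.mk _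
  let B : Finset Λ := Finset.univ.filter fun c => τ (σ c) ≠ σ (τ c)
  have hπ1 : ∀ c, π (τ c) = π c := fun c =>
    (Quotient.sound (s := turnSetoid τ σ) (Relation.EqvGen.rel _ _ (Or.inl rfl))).symm
  have hπ2 : ∀ c, π (σ (τ c)) = π (σ c) := fun c =>
    (Quotient.sound (s := turnSetoid τ σ) (Relation.EqvGen.rel _ _ (Or.inr ⟨c, rfl, rfl⟩))).symm
  have h1 : Fintype.card Λ = ∑ o : Q, (Finset.univ.filter fun c => π c = o).card := by
    rw [← Finset.card_univ]
    exact Finset.card_eq_sum_card_fiberwise (by simp)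
  have h2 : B.card = ∑ o : Q, (B.filter fun c => π (σ c) = o).card :=
    Finset.card_eq_sum_card_fiberwise (by simp)
  have h3 : 6 * Fintype.card Q = ∑ _o : Q, 6 := by simp [mul_comm]
  change B.card + _ ≤ _
  rw [h1, h2, h3, ← Finset.sum_add_distrib, Finset.mul_sum]
  refine Finset.sum_le_sum fun o _ => ?_
  have h4 : (B.filter fun c => π (σ c) = o).card ≤
      (Finset.univ.filter fun c => π c = o).card :=
    Finset.card_le_card_of_injOn σ (by intro c; simp) hσ.1.injOn
  rcases (B.filter fun c => π (σ c) = o).eq_empty_or_nonempty with hB | ⟨c, hc⟩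
  · rw [hB]
    obtain ⟨c, rfl⟩ := Quotient.exists_rep o
    have : ({c, τ c} : Finset Λ).card ≤ (Finset.univ.filter fun d => π d = π c).card := by
      refine Finset.card_le_card ?_
      intro d hd
      simp only [Finset.mem_insert, Finset.mem_singleton] at hd
      rcases hd with rfl | rfl <;> simp [hπ1]
    rw [Finset.card_pair (hτ c).symm] at this
    simp only [Finset.card_empty]
    change 0 + 6 ≤ 3 * (Finset.univ.filter fun d => π d = π c).card
    omega
  · simp only [B, Finset.mem_filter, Finset.mem_univ, true_and] at hc
    obtain ⟨hc, rfl⟩ := hc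
    have : ({σ c, τ (σ c), σ (τ c)} : Finset Λ).card ≤
        (Finset.univ.filter fun d => π d = π (σ c)).card := by
      refine Finset.card_le_card ?_
      intro d hd
      simp only [Finset.mem_insert, Finset.mem_singleton] at hd
      rcases hd with rfl | rfl | rfl <;> simp [hπ1, hπ2]
    rw [Finset.card_eq_three.2 ⟨_, _, _, (hτ _).symm,
      fun h => hτ c (hσ.1 h).symm, hc, rfl⟩] at this
    omega

end Orbits

/-! ### The code words -/

section BlockWord

/-- The positive word `h₁ h₂^{e 0} h₁ h₂^{e 1} ⋯ h₁ h₂^{e (M - 1)}`. -/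
def blockWord (e : ℕ → ℕ) (M : ℕ) : List (Fin 2) :=
  (List.range M).flatMap fun k => 0 :: List.replicate (e k) 1

theorem blockWord_succ (e : ℕ → ℕ) (M : ℕ) :
    blockWord e (M + 1) = blockWord e M ++ 0 :: List.replicate (e M) 1 := by
  simp [blockWord, List.range_succ]

/-- The position in `blockWord e M` at which the block number `k` begins. -/
def blockStart (e : ℕ → ℕ) (k : ℕ) : ℕ := (blockWord e k).length

theorem blockStart_zero (e : ℕ → ℕ) : blockStart e 0 = 0 := by simp [blockStart, blockWord]

theorem blockStart_succ (e : ℕ → ℕ) (k : ℕ) :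
    blockStart e (k + 1) = blockStart e k + e k + 1 := by
  simp [blockStart, blockWord_succ]
  omega

theorem blockStart_strictMono (e : ℕ → ℕ) : StrictMono (blockStart e) :=
  strictMono_nat_of_lt_succ fun k => by rw [blockStart_succ]; omega

theorem blockWord_getElem? (e : ℕ → ℕ) {M k p : ℕ} (hk : k < M) (hp : p ≤ e k) :
    (blockWord e M)[blockStart e k + p]? = some (if p = 0 then 0 else 1) := by
  induction M with
  | zero => omega
  | succ M ih =>
    rw [blockWord_succ]
    rcases Nat.lt_succ_iff_lt_or_eq.1 hk with h | rfl
    · have h1 := (blockStart_strictMono e).monotone (Nat.succ_le_of_lt h)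
      rw [blockStart_succ] at h1
      rw [List.getElem?_append_left (by change _ < blockStart e M; omega), ih h]
    · rw [List.getElem?_append_right (by simp [blockStart])]
      have : blockStart e k + p - (blockWord e k).length = p := by simp [blockStart]
      rw [this]
      cases p with
      | zero => simp
      | succ p =>
        have : p < e k := hp
        simp [this]

theorem exists_block (e : ℕ → ℕ) {M l : ℕ} (hl : l < blockStart e M) :
    ∃ k < M, ∃ p ≤ e k, l = blockStart e k + p := by
  induction M with
  | zero => simp [blockStart_zero] at hl
  | succ M ih =>
    by_cases h : l < blockStart e M
    · obtain ⟨k, hk, p, hp, rfl⟩ := ih h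
      exact ⟨k, by omega, p, hp, rfl⟩
    · rw [blockStart_succ] at hl
      exact ⟨M, by omega, l - blockStart e M, by omega, by omega⟩

/-- The offset `e k + 1` is admitted on purpose: it is the `h₁` opening the cyclically next block,
which marks where the run of `h₂` stops. -/
theorem blockWord_getElem?_mod (e : ℕ → ℕ) {M k p : ℕ} (hk : k < M) (hp : p ≤ e k + 1) :
    (blockWord e M)[(blockStart e k + p) % blockStart e M]? =
      some (if p = 0 ∨ p = e k + 1 then 0 else 1) := by
  have h1 := (blockStart_strictMono e).monotone (Nat.succ_le_of_lt hk)
  rw [Nat.succ_eq_add_one] at h1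
  rcases Nat.le_or_eq_of_le_succ hp with h | rfl
  · rw [blockStart_succ] at h1
    rw [Nat.mod_eq_of_lt (by omega), blockWord_getElem? e hk h]
    have : p ≠ e k + 1 := by omega
    simp [this]
  · rw [Nat.succ_eq_add_one, ← add_assoc, ← blockStart_succ]
    rcases Nat.lt_or_eq_of_le (Nat.succ_le_of_lt hk) with h | h
    · rw [Nat.mod_eq_of_lt (blockStart_strictMono e h)]
      simpa using blockWord_getElem? e h (Nat.zero_le _)
    · rw [← Nat.succ_eq_add_one, h, Nat.mod_self]
      have := blockWord_getElem? e (Nat.zero_lt_of_lt hk) (Nat.zero_le _)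
      rw [blockStart_zero] at this
      simpa using this

/-- The word `∏_{k < N} h₁ h₂^{N i + k + 1}`. -/
def relWord (N i : ℕ) : List (Fin 2) := blockWord (fun k => N * i + k + 1) N

end BlockWord

/-! ### Blocks determine their places -/

section Letters

variable {S : Type*} (N : ℕ) (i : S → ℕ)

/-- The letters of the words `relWord N (i s)`, `s : S`. -/
abbrev Letter := Σ s : S, Fin (relWord N (i s)).length

variable {N i}

namespace Letter

/-- The generator that stands in the given place. -/
def label (c : Letter N i) : Fin 2 := (relWord N (i c.1))[c.2]

/-- The cyclically next letter of the same word. -/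
def next (c : Letter N i) : Letter N i :=
  ⟨c.1, ⟨(c.2 + 1) % (relWord N (i c.1)).length,
    Nat.mod_lt _ (Nat.zero_lt_of_lt c.2.2)⟩⟩

theorem next_injective : Function.Injective (next : Letter N i → Letter N i) := by
  rintro ⟨s, l⟩ ⟨t, l'⟩ h
  obtain rfl : s = t := congrArg Sigma.fst h
  have h1 : (l + 1) % (relWord N (i s)).length = (l' + 1) % (relWord N (i s)).length := by
    simpa [next] using h
  have h2 : l.1 ≡ l'.1 [MOD (relWord N (i s)).length] :=
    Nat.ModEq.add_right_cancel' 1 h1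
  have h3 : l = l' := Fin.ext (by
    rw [← Nat.mod_eq_of_lt l.2, ← Nat.mod_eq_of_lt l'.2]
    exact h2)
  rw [h3]

theorem next_iterate (c : Letter N i) (p : ℕ) :
    next^[p] c = ⟨c.1, ⟨(c.2 + p) % (relWord N (i c.1)).length,
      Nat.mod_lt _ (Nat.zero_lt_of_lt c.2.2)⟩⟩ := by
  induction p with
  | zero =>
    obtain ⟨s, l⟩ := c
    simp [Nat.mod_eq_of_lt l.2]
  | succ p ih =>
    rw [Function.iterate_succ_apply', ih]
    simp [next, add_assoc]

theorem label_next_iterate {c : Letter N i} {k p : ℕ} (hk : k < N)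
    (hc : c.2.1 = blockStart (fun k => N * i c.1 + k + 1) k) (hp : p ≤ N * i c.1 + k + 2) :
    label (next^[p] c) = if p = 0 ∨ p = N * i c.1 + k + 2 then 0 else 1 := by
  rw [next_iterate, label]
  have := blockWord_getElem?_mod (fun k => N * i c.1 + k + 1) hk hp
  rw [← hc] at this
  have h := List.getElem?_eq_some_iff.1 this
  exact h.2

/-- A cyclic subword `h₁ h₂^{N i + k + 1} h₁` determines its place. -/
theorem eq_of_labels {c d : Letter N i} {k : ℕ} (hk : k < N)
    (hc : c.2.1 = blockStart (fun k => N * i c.1 + k + 1) k)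
    (h : ∀ p ≤ N * i c.1 + k + 2, label (next^[p] d) = label (next^[p] c)) :
    i d.1 = i c.1 ∧ d.2.1 = c.2.1 := by
  obtain ⟨k', hk', p', hp', hd⟩ := exists_block (fun k => N * i d.1 + k + 1) d.2.2
  have h0 := h 0 (Nat.zero_le _)
  rw [label_next_iterate hk hc (Nat.zero_le _)] at h0
  -- The word read from `d` starts with `h₁`, so `d` opens a block.
  have hp0 : p' = 0 := by
    by_contra hne
    have h1 := blockWord_getElem? (fun k => N * i d.1 + k + 1) hk' hp'
    rw [← hd, if_neg hne] at h1
    have h2 := (List.getElem?_eq_some_iff.1 h1).2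
    have h3 : label d = 1 := h2
    simp [h3] at h0
  subst hp0
  rw [add_zero] at hd
  -- The shorter of the two runs of `h₂` would be followed by `h₁` in one reading and by `h₂` in the
  -- other. Division by `N` then recovers `i` and the block number.
  have key : N * i c.1 + k = N * i d.1 + k' := by
    rcases lt_trichotomy (N * i c.1 + k) (N * i d.1 + k') with hlt | heq | hgt
    · have h1 := h (N * i c.1 + k + 2) le_rfl
      rw [label_next_iterate hk hc le_rfl, label_next_iterate hk' hd (by omega)] at h1
      rw [if_neg (by omega), if_pos (by omega)] at h1
      simp at h1
    · exact heq
    · have h1 := h (N * i d.1 + k' + 2) (by omega)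
      rw [label_next_iterate hk hc (by omega), label_next_iterate hk' hd (by omega)] at h1
      rw [if_pos (by omega), if_neg (by omega)] at h1
      simp at h1
  have hN : 0 < N := by omega
  have hi : i d.1 = i c.1 := by
    have h1 := congrArg (· / N) key
    simp only [Nat.mul_add_div hN, Nat.div_eq_of_lt hk, Nat.div_eq_of_lt hk'] at h1
    omega
  have hkk : k' = k := by rw [hi] at key; omega
  refine ⟨hi, ?_⟩
  rw [hd, hc, hi, hkk]

open Classical in
/-- If a label-preserving map never matches letters in the same place of equal words, then in each
block it fails at least once to commute with passing to the next letter. -/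
theorem mul_card_le [Fintype S] (τ : Letter N i → Letter N i)
    (hτ : ∀ c, label (τ c) = label c)
    (hne : ∀ c, i (τ c).1 = i c.1 → (τ c).2.1 ≠ c.2.1) :
    N * Fintype.card S ≤ (Finset.univ.filter fun c => τ (next c) ≠ next (τ c)).card := by
  have key : ∀ x : S × Fin N, ∃ c : Letter N i, τ (next c) ≠ next (τ c) ∧ c.1 = x.1 ∧
      ∃ p ≤ N * i x.1 + x.2 + 1,
        c.2.1 = blockStart (fun k => N * i x.1 + k + 1) x.2 + p := by
    rintro ⟨s, k⟩
    by_contra hcon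
    push Not at hcon
    have hlt : ∀ p ≤ N * i s + k + 1, blockStart (fun k => N * i s + k + 1) k + p <
        (relWord N (i s)).length := by
      intro p hp
      have h1 := (blockStart_strictMono fun k => N * i s + k + 1).monotone
        (Nat.succ_le_of_lt k.2)
      rw [Nat.succ_eq_add_one, blockStart_succ] at h1
      have h2 : blockStart (fun k => N * i s + k + 1) N = (relWord N (i s)).length := rfl
      omega
    let c : Letter N i := ⟨s, ⟨blockStart (fun k => N * i s + k + 1) k, by
      simpa using hlt 0 (by omega)⟩⟩
    -- With no failure inside the block, `τ` carries it letter by letter onto an equally labelled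
    -- stretch, including the `h₁` after it.
    have h1 : ∀ p ≤ N * i s + k + 2, τ (next^[p] c) = next^[p] (τ c) := by
      intro p hp
      induction p with
      | zero => rfl
      | succ p ih =>
        rw [Function.iterate_succ_apply', Function.iterate_succ_apply', ← ih (by omega)]
        by_contra h2
        refine hcon _ h2 ?_ p (show p ≤ N * i s + k + 1 by omega) ?_
        · rw [next_iterate]
        · rw [next_iterate]
          exact Nat.mod_eq_of_lt (hlt p (by omega))
    have h2 := eq_of_labels (c := c) (d := τ c) k.2 rfl fun p hp => by rw [← h1 p hp, hτ]
    exact hne c h2.1 h2.2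
  choose f hf1 hf2 p hp hf3 using key
  -- The chosen letters lie in their own blocks, and blocks are disjoint intervals.
  have hf : Function.Injective f := by
    rintro ⟨s, k⟩ ⟨t, k'⟩ h
    have h1 := hf2 (s, k)
    have h2 := hf2 (t, k')
    dsimp only at h1 h2
    obtain rfl : s = t := by rw [← h1, ← h2, h]
    have h3 := hf3 (s, k)
    have h4 := hf3 (s, k')
    have h5 := hp (s, k)
    have h6 := hp (s, k')
    rw [h] at h3
    simp only at h3 h4 h5 h6
    have hmono := (blockStart_strictMono fun k => N * i s + k + 1).monotone
    have : k = k' := by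
      rcases lt_trichotomy k k' with hlt | heq | hgt
      · have := hmono (Nat.succ_le_of_lt hlt)
        rw [Nat.succ_eq_add_one, blockStart_succ] at this
        omega
      · exact heq
      · have := hmono (Nat.succ_le_of_lt hgt)
        rw [Nat.succ_eq_add_one, blockStart_succ] at this
        omega
    rw [this]
  calc N * Fintype.card S = Fintype.card (S × Fin N) := by simp [mul_comm]
    _ = (Finset.univ.image f).card := by rw [Finset.card_image_of_injective _ hf, Finset.card_univ]
    _ ≤ _ := Finset.card_le_card (by
      intro c hc
      obtain ⟨x, -, rfl⟩ := Finset.mem_image.1 hc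
      simpa using hf1 x)

end Letter

end Letters

/-! ### Counting occurrences -/

section Occurrences

variable {A X B Z : Type*}

@[simp]
theorem occ_nil (x : X) : occ x ([] : Word (A ⊕ X)) = 0 := by simp [occ]

open Classical in
theorem occ_cons (x : X) (a : (A ⊕ X) × Bool) (L : Word (A ⊕ X)) :
    occ x (a :: L) = occ x L + if a.1 = Sum.inr x then 1 else 0 := by
  simp [occ, List.countP_cons]

theorem occ_append (x : X) (L M : Word (A ⊕ X)) : occ x (L ++ M) = occ x L + occ x M := by
  simp [occ, List.countP_append]

theorem occ_invRev (x : X) (L : Word (A ⊕ X)) : occ x (FreeGroup.invRev L) = occ x L := by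
  simp [occ, FreeGroup.invRev, List.countP_map, Function.comp_def]

theorem count_filterMap_getRight? [DecidableEq X] (x : X) (L : Word (A ⊕ X)) :
    (L.filterMap fun a => a.1.getRight?).count x = occ x L := by
  induction L with
  | nil => simp
  | cons a L ih =>
    obtain ⟨a | y, ε⟩ := a
    · simp [occ_cons, List.filterMap_cons, ih]
    · simp [occ_cons, ih, List.count_cons]

theorem occ_subst (x : Z) (s : A → Word (B ⊕ Z)) (L : Word A) :
    occ x (subst s L) = (L.map fun a => occ x (s a.1)).sum := by
  induction L with
  | nil => simp
  | cons a L ih =>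
    rcases a with ⟨a, _ | _⟩ <;> simp [subst_cons, occ_append, occ_invRev, ih]

theorem mem_vars {x : X} {W : Word (A ⊕ X)} : x ∈ vars W ↔ ∃ a ∈ W, a.1 = Sum.inr x := by
  simp [vars]

theorem occ_eq_zero_of_notMem_vars {x : X} {W : Word (A ⊕ X)} (h : x ∉ vars W) :
    occ x W = 0 := by
  rw [mem_vars] at h
  push Not at h
  simp only [occ, List.countP_eq_zero]
  exact fun a ha => by simpa using h a ha

open Classical in
/-- The number of occurrences of the letter `a` or its inverse in a word. -/
noncomputable def letterCount (a : A) (L : Word A) : ℕ := L.countP fun l => decide (l.1 = a)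

theorem letterCount_inr (x : X) (W : Word (A ⊕ X)) : letterCount (Sum.inr x) W = occ x W := by
  simp only [letterCount, occ]
  congr!

theorem letterCount_eq_count [DecidableEq A] (a : A) (L : Word A) :
    letterCount a L = @List.count A instBEqOfDecidableEq a (L.map Prod.fst) := by
  simp only [letterCount, List.count, List.countP_map]
  congr! 1
  ext l
  simp [beq_eq_decide]

theorem sum_map_ite_eq [DecidableEq A] (L : Word A) (a : A) (m : ℕ) :
    (L.map fun l => if l.1 = a then m else 0).sum = letterCount a L * m := by
  induction L with
  | nil => simp [letterCount]
  | cons l L ih =>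
    rw [letterCount] at ih ⊢
    by_cases h : l.1 = a <;> simp [h, ih, add_mul, add_comm]

theorem pairCount_eq_occ {G : Type*} [Group G] [DecidableEq X] {L : Word (G ⊕ X)}
    {P : List ((G × X) × (G × X))} (hP : Paired (unfold 1 L) P) (x : X) :
    pairCount (P.map fun p => (p.1.2, p.2.2)) x = occ x L := by
  rw [← count_filterMap_getRight?, ← unfold_map_snd 1]
  have h := (hP.perm.map Prod.snd).count_eq x
  rw [List.map_map] at h
  refine Eq.trans ?_ h.symm
  simp [pairCount, List.map_flatMap, List.flatMap_map]

end Occurrences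

/-! ### Tagging letters with their positions -/

section Tags

variable {G T Lab K : Type*} [Group K]

/-- Mark every letter of `Lab` with the tag `t` and with its position (counted from `n`). -/
def tagFrom (t : T) : ℕ → Word (G ⊕ Lab) → Word (G ⊕ (T × ℕ × Lab))
  | _, [] => []
  | n, a :: L => (Sum.map id (fun k => (t, n, k)) a.1, a.2) :: tagFrom t (n + 1) L

theorem wordEval_tagFrom (f : G ⊕ Lab → K) (t : T) (n : ℕ) (L : Word (G ⊕ Lab)) :
    wordEval (fun a => f (Sum.map id (fun y : T × ℕ × Lab => y.2.2) a)) (tagFrom t n L) =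
      wordEval f L := by
  induction L generalizing n with
  | nil => simp [tagFrom]
  | cons a L ih => obtain ⟨a | y, ε⟩ := a <;> simp [tagFrom, wordEval_cons, ih]

theorem occ_tagFrom_of_ne {t t' : T} (h : t' ≠ t) (p : ℕ) (k : Lab) (n : ℕ)
    (L : Word (G ⊕ Lab)) : occ (t', p, k) (tagFrom t n L) = 0 := by
  induction L generalizing n with
  | nil => simp [tagFrom]
  | cons a L ih => obtain ⟨a | y, ε⟩ := a <;> simp [tagFrom, occ_cons, ih, h.symm]

theorem occ_tagFrom_of_lt (t : T) {n p : ℕ} (h : p < n) (k : Lab)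
    (L : Word (G ⊕ Lab)) : occ (t, p, k) (tagFrom t n L) = 0 := by
  induction L generalizing n with
  | nil => simp [tagFrom]
  | cons a L ih =>
    obtain ⟨a | y, ε⟩ := a <;> simp [tagFrom, occ_cons, ih (Nat.lt_succ_of_lt h), h.ne']

theorem occ_tagFrom_le_one (t : T) (p : ℕ) (k : Lab) (n : ℕ)
    (L : Word (G ⊕ Lab)) : occ (t, p, k) (tagFrom t n L) ≤ 1 := by
  induction L generalizing n with
  | nil => simp [tagFrom]
  | cons a L ih =>
    by_cases h : p = n
    · subst h
      rw [tagFrom, occ_cons, occ_tagFrom_of_lt t (Nat.lt_succ_self p)]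
      split_ifs <;> simp
    · obtain ⟨a | y, ε⟩ := a
      · simpa [tagFrom, occ_cons] using ih _
      · simpa [tagFrom, occ_cons, Ne.symm h] using ih _

/-- The word without inverse letters given by a list of letters of `Lab`. -/
def posWord (L : List Lab) : Word (G ⊕ Lab) := L.map fun k => (Sum.inr k, true)

open Classical in
theorem occ_tagFrom_posWord (t : T) (p : ℕ) (k : Lab) (n : ℕ) (L : List Lab) :
    occ (t, n + p, k) (tagFrom t n (posWord L : Word (G ⊕ Lab))) =
      if L[p]? = some k then 1 else 0 := by
  induction L generalizing n p with
  | nil => simp [tagFrom, posWord]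
  | cons a L ih =>
    rw [posWord, List.map_cons, tagFrom, occ_cons]
    cases p with
    | zero =>
      rw [occ_tagFrom_of_lt t (by omega)]
      simp
    | succ p =>
      have := ih p (n + 1)
      rw [posWord, show n + 1 + p = n + (p + 1) by omega] at this
      simp [this]

theorem wordEval_tagFrom_posWord (c : G → K) (f : T × ℕ × Lab → K) (t : T) (n : ℕ)
    (L : List Lab) :
    wordEval (Sum.elim c f) (tagFrom t n (posWord L)) =
      ((List.range L.length).map fun l => (L[l]?).elim 1 fun k => f (t, n + l, k)).prod := by
  induction L generalizing n with
  | nil => simp [tagFrom, posWord]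
  | cons a L ih =>
    have := ih (n + 1)
    rw [posWord] at this
    rw [posWord, List.map_cons, tagFrom, wordEval_cons, this, List.length_cons,
      List.range_succ_eq_map, List.map_cons, List.prod_cons, List.map_map]
    simp [Function.comp_def, add_assoc, add_comm 1]

end Tags

theorem Heis.prod_range_x (F : ℕ → Heis) (n : ℕ) :
    ((List.range n).map F).prod.x = ∑ l ∈ Finset.range n, (F l).x := by
  induction n with
  | zero => simp
  | succ n ih => simp [List.range_succ, Finset.sum_range_succ, ih]

/-- The third coordinate of a product collects `x_j y_l` over `j < l`; this is what will count
crossings of arcs. -/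
theorem Heis.prod_range_z (F : ℕ → Heis) (n : ℕ) (hF : ∀ l, (F l).z = 0) :
    ((List.range n).map F).prod.z =
      ∑ l ∈ Finset.range n, (∑ j ∈ Finset.range l, (F j).x) * (F l).y := by
  induction n with
  | zero => simp
  | succ n ih => simp [List.range_succ, Finset.sum_range_succ, ih, hF, Heis.prod_range_x]

open Classical in
/-- A sum over the letters of a word in which each variable occurs twice or never, modulo `2`. -/
theorem sum_letters_eq {A S V : Type*} [Fintype S] (g : (A ⊕ S) ⊕ V → ZMod 2)
    (W : Word ((A ⊕ S) ⊕ V)) (hA : ∀ a, g (Sum.inl (Sum.inl a)) = 0)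
    (hS : ∀ s, letterCount (Sum.inl (Sum.inr s)) W = 1)
    (hV : ∀ v, occ v W = 2 ∨ occ v W = 0) :
    (W.map fun a => g a.1).sum = ∑ s, g (Sum.inl (Sum.inr s)) := by
  have h1 : (W.map fun a => g a.1).sum = ((W.map Prod.fst).map g).sum := by
    simp [Function.comp_def]
  rw [h1, Finset.sum_list_map_count]
  simp only [← letterCount_eq_count]
  have h2 : (Finset.univ.image fun s : S => (Sum.inl (Sum.inr s) : (A ⊕ S) ⊕ V)) ⊆
      (W.map Prod.fst).toFinset := by
    intro a ha
    obtain ⟨s, -, rfl⟩ := Finset.mem_image.1 ha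
    have : 0 < letterCount (Sum.inl (Sum.inr s)) W := by rw [hS s]; exact one_pos
    rw [letterCount, List.countP_pos_iff] at this
    obtain ⟨l, hl, h⟩ := this
    exact List.mem_toFinset.2 (List.mem_map.2 ⟨l, hl, by simpa using h⟩)
  rw [← Finset.sum_subset h2, Finset.sum_image (by intro s _ t _ h; simpa using h)]
  · simp [hS]
  · rintro ((a | s) | v) _ h
    · simp [hA]
    · simp at h
    · rw [letterCount_inr]
      rcases hV v with h | h <;> rw [h]
      · rw [two_nsmul, CharTwo.add_self_eq_zero]
      · simp

/-- An additive map between these spaces is linear over the field with two elements, so dimensions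
can be compared. -/
theorem card_le_of_joint_injective {E J O : Type*} [Fintype E] [Fintype J] [Fintype O]
    (Φ : (E → ZMod 2) →+ (J → ZMod 2)) (Ψ : (E → ZMod 2) →+ (O → ZMod 2))
    (h : ∀ v, Φ v = 0 → Ψ v = 0 → v = 0) :
    Fintype.card E ≤ Fintype.card J + Fintype.card O := by
  let Θ : (E → ZMod 2) →ₗ[ZMod 2] (J → ZMod 2) × (O → ZMod 2) :=
    (Φ.prod Ψ).toZModLinearMap 2
  have hΘ : Function.Injective Θ := by
    rw [injective_iff_map_eq_zero]
    intro v hv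
    have : (Φ v, Ψ v) = 0 := hv
    exact h v (congrArg Prod.fst this) (congrArg Prod.snd this)
  have := LinearMap.finrank_le_finrank_of_injective hΘ
  simpa using this

/-! ### Matching and cancelling relators -/

section Cancellation

variable {G A S V : Type*} [Group G]

/-- The relator `g⁻¹ h₁ h₂^{…} h₁ h₂^{…} ⋯`, `g = b i`, of the free product `G * F(h₁, h₂)`. -/
def relator (N : ℕ) (b : ℕ → G) (i : ℕ) : FP G (Fin 2) :=
  wordEval fpLetter ((Sum.inl (b i), false) :: posWord (relWord N i))

/-- The slots: tagged positions of letters `h₁`, `h₂`. -/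
abbrev Slot (S V : Type*) := (V ⊕ S) × ℕ × Fin 2

/-- The word over `G` and the slots that replaces the letter in the word `W`. -/
def slotWord (N : ℕ) (b : ℕ → G) (i : S → ℕ) (c : A → G) (u : V → Word (G ⊕ Fin 2)) :
    (A ⊕ S) ⊕ V → Word (G ⊕ Slot S V) :=
  Sum.elim (Sum.elim (fun a => [(Sum.inl (c a), true)]) fun s =>
    (Sum.inl (b (i s)), false) :: tagFrom (Sum.inr s) 0 (posWord (relWord N (i s))))
    fun v => tagFrom (Sum.inl v) 0 (u v)

variable {N : ℕ} {b : ℕ → G} {i : S → ℕ} {c : A → G} {u : V → Word (G ⊕ Fin 2)}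

theorem wordEval_slotWord_relabel (a : (A ⊕ S) ⊕ V) :
    wordEval (fun y => fpLetter (Sum.map id (fun y : Slot S V => y.2.2) y))
        (slotWord N b i c u a) =
      Sum.elim (Sum.elim (fun a => Monoid.Coprod.inl (c a)) fun s => relator N b (i s))
        (fun v => wordEval fpLetter (u v)) a := by
  obtain (a | s) | v := a
  · simp [slotWord, wordEval_cons, fpLetter]
  · rw [slotWord, Sum.elim_inl, Sum.elim_inr, wordEval_cons, wordEval_tagFrom, Sum.elim_inl,
      Sum.elim_inr, relator, wordEval_cons]
    simp
  · simp only [slotWord, Sum.elim_inr]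
    exact wordEval_tagFrom _ _ _ _

/-- The slot of a letter of a relator. -/
def Letter.slot (d : Letter N i) : Slot S V := (Sum.inr d.1, d.2.1, d.label)

theorem Letter.slot_injective :
    Function.Injective (Letter.slot : Letter N i → Slot S V) := by
  rintro ⟨s, l⟩ ⟨t, l'⟩ h
  simp only [Letter.slot, Prod.mk.injEq, Sum.inr.injEq] at h
  obtain ⟨rfl, h, -⟩ := h
  rw [Fin.ext h]

open Classical in
theorem occ_slotWord_var (v : V) (p : ℕ) (k : Fin 2) (a : (A ⊕ S) ⊕ V) :
    occ (Sum.inl v, p, k) (slotWord N b i c u a) =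
      if a = Sum.inr v then occ (Sum.inl v, p, k) (tagFrom (Sum.inl v : V ⊕ S) 0 (u v)) else 0 := by
  obtain (a | s) | v' := a
  · simp [slotWord, occ_cons]
  · simp [slotWord, occ_cons, occ_tagFrom_of_ne]
  · by_cases h : v' = v
    · subst h; simp [slotWord]
    · simp only [slotWord, Sum.elim_inr, Sum.inr.injEq, h, if_false]
      exact occ_tagFrom_of_ne (by simpa using Ne.symm h) _ _ _ _

open Classical in
theorem occ_slotWord_cell (s : S) (p : ℕ) (k : Fin 2) (a : (A ⊕ S) ⊕ V) :
    occ (Sum.inr s, p, k) (slotWord N b i c u a) =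
      if a = Sum.inl (Sum.inr s) then (if (relWord N (i s))[p]? = some k then 1 else 0) else 0 := by
  obtain (a | t) | v := a
  · simp [slotWord, occ_cons]
  · by_cases h : t = s
    · subst h
      have := occ_tagFrom_posWord (G := G) (Sum.inr t : V ⊕ S) p k 0 (relWord N (i t))
      rw [zero_add] at this
      simp [slotWord, occ_cons, this]
    · have : (Sum.inr s : V ⊕ S) ≠ Sum.inr t := by simpa using Ne.symm h
      simp [slotWord, occ_cons, occ_tagFrom_of_ne this, h]
  · simp [slotWord, occ_tagFrom_of_ne]

theorem occ_subst_slotWord_var {W : Word ((A ⊕ S) ⊕ V)}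
    (hV : ∀ v, occ v W = 2 ∨ occ v W = 0) (v : V) (p : ℕ) (k : Fin 2) :
    occ (Sum.inl v, p, k) (subst (slotWord N b i c u) W) = 2 ∨
      occ (Sum.inl v, p, k) (subst (slotWord N b i c u) W) = 0 := by
  classical
  rw [occ_subst]
  simp only [occ_slotWord_var]
  rw [sum_map_ite_eq, letterCount_inr]
  have := occ_tagFrom_le_one (Sum.inl v : V ⊕ S) p k 0 (u v)
  interval_cases h : occ (Sum.inl v, p, k) (tagFrom (Sum.inl v : V ⊕ S) 0 (u v))
  · simp
  · simpa using hV v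

open Classical in
theorem occ_subst_slotWord_cell {W : Word ((A ⊕ S) ⊕ V)}
    (hS : ∀ s, letterCount (Sum.inl (Sum.inr s)) W = 1) (s : S) (p : ℕ) (k : Fin 2) :
    occ (Sum.inr s, p, k) (subst (slotWord N b i c u) W) =
      if (relWord N (i s))[p]? = some k then 1 else 0 := by
  rw [occ_subst]
  simp only [occ_slotWord_cell]
  rw [sum_map_ite_eq, hS, one_mul]

/-- Slots inside variables occur an even number of times, so the end points of the arcs are exactly
the letters of the relators. -/
theorem occ_subst_slotWord_eq_one_iff {W : Word ((A ⊕ S) ⊕ V)}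
    (hV : ∀ v, occ v W = 2 ∨ occ v W = 0)
    (hS : ∀ s, letterCount (Sum.inl (Sum.inr s)) W = 1) (y : Slot S V) :
    occ y (subst (slotWord N b i c u) W) = 1 ↔ ∃ d : Letter N i, d.slot = y := by
  classical
  obtain ⟨v | s, p, k⟩ := y
  · have h1 := occ_subst_slotWord_var (N := N) (b := b) (i := i) (c := c) (u := u) hV v p k
    have h2 : ¬ ∃ d : Letter N i, (d.slot : Slot S V) = (Sum.inl v, p, k) := by
      simp [Letter.slot]
    constructor
    · intro h; omega
    · exact fun h => absurd h h2
  · rw [occ_subst_slotWord_cell hS]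
    constructor
    · intro h
      have h1 : (relWord N (i s))[p]? = some k := by
        by_contra h2
        simp [h2] at h
      obtain ⟨hp, h2⟩ := List.getElem?_eq_some_iff.1 h1
      exact ⟨⟨s, p, hp⟩, by simp [Letter.slot, Letter.label, h2]⟩
    · rintro ⟨⟨t, l⟩, h⟩
      simp only [Letter.slot, Letter.label, Prod.mk.injEq, Sum.inr.injEq] at h
      obtain ⟨rfl, rfl, rfl⟩ := h
      rw [if_pos]
      simp

/-- Letters of the relators are matched in such a way that the matching extends to an assignment of
values to all slots. -/
theorem exists_matching {W : Word ((A ⊕ S) ⊕ V)}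
    (hV : ∀ v, occ v W = 2 ∨ occ v W = 0)
    (hS : ∀ s, letterCount (Sum.inl (Sum.inr s)) W = 1)
    (hW : wordEval (Sum.elim (Sum.elim (fun a => Monoid.Coprod.inl (c a))
      fun s => relator N b (i s)) (fun v => wordEval fpLetter (u v))) W = 1) :
    ∃ (P : List ((G × Slot S V) × (G × Slot S V))) (q : Slot S V → Slot S V)
      (τ : Letter N i → Letter N i),
      Paired (unfold 1 (subst (slotWord N b i c u) W)) P ∧
      (∀ p ∈ P, p.1.1 = p.2.1) ∧
      wordEval (Sum.elim id fun _ => 1) (subst (slotWord N b i c u) W) = (1 : G) ∧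
      (∀ p ∈ P, q p.1.2 = q p.2.2) ∧ (∀ p ∈ P, p.1.2.2.2 = p.2.2.2.2) ∧
      (∀ d, (τ d).label = d.label) ∧ (∀ d, τ d ≠ d) ∧ (∀ d, q (τ d).slot = q d.slot) ∧
      ∀ d d' : Letter N i, q d'.slot = q d.slot → d' = d ∨ d' = τ d := by
  classical
  have h1 : wordEval (fun y => fpLetter (Sum.map id (fun y : Slot S V => y.2.2) y))
      (subst (slotWord N b i c u) W) = 1 := by
    rw [wordEval_subst]
    simp only [wordEval_slotWord_relabel]
    exact hW
  -- The edges of the multigraph are the cancelling pairs; since each variable occurs twice or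
  -- never, an arc runs through slots of variables from one letter of a relator to another.
  obtain ⟨P, hP, hP1, hP2⟩ := exists_pairing _ _ h1
  let P' : List (Slot S V × Slot S V) := P.map fun p => (p.1.2, p.2.2)
  have hcount : ∀ y, pairCount P' y = occ y (subst (slotWord N b i c u) W) := pairCount_eq_occ hP
  have hle : ∀ y, pairCount P' y ≤ 2 := by
    rintro ⟨v | s, p, k⟩ <;> rw [hcount]
    · rcases occ_subst_slotWord_var (N := N) (b := b) (i := i) (c := c) (u := u) hV v p k
        with h | h <;> omega
    · rw [occ_subst_slotWord_cell hS]
      split_ifs <;> omega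
  obtain ⟨q, hq1, hq2, -, hq4⟩ := exists_arcs (fun y : Slot S V => y.2.2) P' (by
    intro p hp
    obtain ⟨p', hp', rfl⟩ := List.mem_map.1 hp
    exact (hP1 p' hp').2) hle
  have h3 : ∀ d : Letter N i, ∃ d' : Letter N i, d' ≠ d ∧ q d'.slot = q d.slot ∧
      ∀ d'' : Letter N i, q d''.slot = q d.slot → d'' = d ∨ d'' = d' := by
    intro d
    obtain ⟨v, hv, hv1, hv2, hv3⟩ := hq4 d.slot (by
      rw [hcount, occ_subst_slotWord_eq_one_iff hV hS]; exact ⟨d, rfl⟩)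
    rw [hcount, occ_subst_slotWord_eq_one_iff hV hS] at hv1
    obtain ⟨d', rfl⟩ := hv1
    refine ⟨d', fun h => hv (by rw [h]), hv2, fun d'' hd => ?_⟩
    rcases hv3 d''.slot (by
      rw [hcount, occ_subst_slotWord_eq_one_iff hV hS]; exact ⟨d'', rfl⟩) hd with h | h
    · exact Or.inl (Letter.slot_injective h)
    · exact Or.inr (Letter.slot_injective h)
  choose τ hτ1 hτ2 hτ3 using h3
  exact ⟨P, q, τ, hP, fun p hp => (hP1 p hp).1, hP2,
    fun p hp => hq1 (p.1.2, p.2.2) (List.mem_map.2 ⟨p, hp, rfl⟩), fun p hp => (hP1 p hp).2,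
    fun d => hq2 _ _ (hτ2 d), hτ1, hτ2, hτ3⟩

end Cancellation

section Cancellation

variable {G A S V K : Type*} [Group G] [Group K]
variable {N : ℕ} {b : ℕ → G} {i : S → ℕ} {c : A → G} {u : V → Word (G ⊕ Fin 2)}

theorem wordEval_slotWord_cell (φ : G →* K) (f : Slot S V → K) (s : S) :
    wordEval (Sum.elim φ f) (slotWord N b i c u (Sum.inl (Sum.inr s))) =
      (φ (b (i s)))⁻¹ * ((List.range (relWord N (i s)).length).map fun l =>
        ((relWord N (i s))[l]?).elim 1 fun k => f (Sum.inr s, l, k)).prod := by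
  simp [slotWord, wordEval_cons, wordEval_tagFrom_posWord]

theorem relator_eq (j : ℕ) : relator N b j =
    (Monoid.Coprod.inl (b j))⁻¹ *
      ((relWord N j).map fun k => Monoid.Coprod.inr (FreeGroup.of k)).prod := by
  rw [relator, wordEval_cons]
  congr 1
  generalize relWord N j = L
  induction L with
  | nil => simp [posWord]
  | cons k L ih =>
    rw [posWord, List.map_cons, wordEval_cons, ← posWord, ih]
    simp [fpLetter]

theorem map_range_getElem?_elim {Lab : Type*} (L : List Lab) (g : ℕ → Lab → K) :
    ((List.range L.length).map fun l => (L[l]?).elim 1 (g l)) = L.mapIdx g := by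
  refine List.ext_getElem (by simp) fun l h1 h2 => ?_
  have : l < L.length := by simpa using h2
  simp [this]

/-- If matched letters occupy the same place of two relators, these relators can be cancelled. -/
theorem exists_cancelled {W : Word ((A ⊕ S) ⊕ V)} {P : List ((G × Slot S V) × (G × Slot S V))}
    {q : Slot S V → Slot S V}
    (hP : Paired (unfold 1 (subst (slotWord N b i c u) W)) P)
    (hP₁ : ∀ p ∈ P, p.1.1 = p.2.1)
    (hP₂ : wordEval (Sum.elim id fun _ => 1) (subst (slotWord N b i c u) W) = (1 : G))
    (hq : ∀ p ∈ P, q p.1.2 = q p.2.2) (hℓ : ∀ p ∈ P, p.1.2.2.2 = p.2.2.2.2)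
    {d d' : Letter N i} (hdd : q d'.slot = q d.slot) (hd : d' ≠ d)
    (hq' : ∀ d'' : Letter N i, q d''.slot = q d.slot → d'' = d ∨ d'' = d')
    (hi : i d'.1 = i d.1) (hl : d'.2.1 = d.2.1) :
    ∃ (s t : S) (x : V → FP G (Fin 2)), s ≠ t ∧ ∃ ρ : S → FP G (Fin 2), ρ s = 1 ∧ ρ t = 1 ∧
      (∀ r, r ≠ s → r ≠ t → ρ r = relator N b (i r)) ∧
      wordEval (Sum.elim (Sum.elim (fun a => Monoid.Coprod.inl (c a)) ρ) x) W = 1 := by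
  classical
  let h : Fin 2 → FP G (Fin 2) := fun k => Monoid.Coprod.inr (FreeGroup.of k)
  let H : List (FP G (Fin 2)) := (relWord N (i d.1)).map h
  -- The unique value of the letter `d` for which its relator `g⁻¹ · prefix · letter · suffix`
  -- becomes trivial. The letter `d'`, in the same place of an equal word, then trivializes the
  -- second relator too.
  let κ : FP G (Fin 2) :=
    (H.take d.2.1).prod⁻¹ * Monoid.Coprod.inl (b (i d.1)) * (H.drop (d.2.1 + 1)).prod⁻¹
  let f : Slot S V → FP G (Fin 2) := fun y => if q y = q d.slot then κ else h y.2.2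
  -- In one and the same relator, equal positions would mean equal letters.
  have hst : d.1 ≠ d'.1 := by
    rintro hs
    obtain ⟨s, l⟩ := d
    obtain ⟨t, l'⟩ := d'
    dsimp only at hs hl
    subst hs
    exact hd (by rw [Fin.ext hl])
  have h1 : wordEval (fun a => wordEval (Sum.elim (Monoid.Coprod.inl : G →* FP G (Fin 2)) f)
      (slotWord N b i c u a)) W = 1 := by
    rw [← wordEval_subst]
    refine wordEval_eq_one_of_pairing hP hP₁ hP₂ _ _ fun p hp => ?_
    simp only [f, hq p hp, hℓ p hp]
  have hcell : ∀ r, wordEval (Sum.elim (Monoid.Coprod.inl : G →* FP G (Fin 2)) f)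
      (slotWord N b i c u (Sum.inl (Sum.inr r))) = (Monoid.Coprod.inl (b (i r)))⁻¹ *
        ((relWord N (i r)).mapIdx fun l k => f (Sum.inr r, l, k)).prod := by
    intro r
    rw [wordEval_slotWord_cell, map_range_getElem?_elim]
  have hone : ∀ e : Letter N i, (e = d ∨ e = d') → i e.1 = i d.1 → e.2.1 = d.2.1 →
      wordEval (Sum.elim (Monoid.Coprod.inl : G →* FP G (Fin 2)) f)
      (slotWord N b i c u (Sum.inl (Sum.inr e.1))) = 1 := by
    intro e he hei hel
    rw [hcell]
    have hlen : d.2.1 < H.length := by simp [H]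
    have h2 : ((relWord N (i e.1)).mapIdx fun l k => f (Sum.inr e.1, l, k)) =
        H.set d.2.1 κ := by
      refine List.ext_getElem (by simp [H, hei]) fun l hl1 hl2 => ?_
      rw [List.getElem_mapIdx, List.getElem_set]
      have hl3 : l < (relWord N (i e.1)).length := by simpa using hl1
      let e' : Letter N i := ⟨e.1, l, hl3⟩
      change f e'.slot = _
      by_cases hle : d.2.1 = l
      · have : e' = e := by
          obtain ⟨s, m⟩ := e
          simp only [e']
          congr 1
          exact Fin.ext (hle.symm.trans hel.symm)
        rw [if_pos hle, this]
        rcases he with rfl | rfl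
        · simp [f]
        · simp [f, hdd]
      · rw [if_neg hle]
        have hne : q e'.slot ≠ q d.slot := by
          intro hqq
          rcases hq' e' hqq with h3 | h3
          · exact hle (by rw [← h3])
          · exact hle (by rw [← hl, ← h3])
        simp only [f, hne, if_false, H, List.getElem_map]
        congr 1
        change (relWord N (i e.1))[l] = _
        congr 1
        rw [hei]
    rw [h2, List.prod_set, if_pos hlen, hei]
    simp only [κ]
    group
  refine ⟨d.1, d'.1, fun v => wordEval (Sum.elim (Monoid.Coprod.inl : G →* FP G (Fin 2)) f)
      (slotWord N b i c u (Sum.inr v)), hst,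
    fun s => wordEval (Sum.elim (Monoid.Coprod.inl : G →* FP G (Fin 2)) f)
      (slotWord N b i c u (Sum.inl (Sum.inr s))), hone d (Or.inl rfl) rfl rfl,
    hone d' (Or.inr rfl) hi hl, ?_, ?_⟩
  · intro r hr hr'
    beta_reduce
    rw [hcell, relator_eq]
    congr 2
    refine List.ext_getElem (by simp) fun l hl1 hl2 => ?_
    rw [List.getElem_mapIdx, List.getElem_map]
    have hl3 : l < (relWord N (i r)).length := by simpa using hl1
    let e' : Letter N i := ⟨r, l, hl3⟩
    have hne : q e'.slot ≠ q d.slot := by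
      intro hqq
      rcases hq' e' hqq with h3 | h3
      · exact hr (congrArg Sigma.fst h3)
      · exact hr' (congrArg Sigma.fst h3)
    change f e'.slot = _
    simp only [f, hne, if_false]
    rfl
  · refine Eq.trans ?_ h1
    congr 1
    ext1 ((a | s) | v)
    · simp [slotWord, wordEval_cons]
    · simp
    · simp

end Cancellation

/-! ### The Euler characteristic bound -/

section Counting

variable {G A S V : Type*} [Group G]
variable {N : ℕ} {b : ℕ → G} {i : S → ℕ} {c : A → G} {u : V → Word (G ⊕ Fin 2)}

/-- The sum of the values of `g` at the first letters of a relator, up to a given one. -/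
def prefixSum (g : Slot S V → ZMod 2) (d : Letter N i) : ZMod 2 :=
  ∑ j ∈ Finset.range d.2.1, ((relWord N (i d.1))[j]?).elim 0 fun k => g (Sum.inr d.1, j, k)

/-- The hypothesis matters only at the last letter, whose successor is the first one, with empty
prefix sum. -/
theorem prefixSum_next (g : Slot S V → ZMod 2) (d : Letter N i)
    (h : ∑ j ∈ Finset.range (relWord N (i d.1)).length,
      ((relWord N (i d.1))[j]?).elim 0 (fun k => g (Sum.inr d.1, j, k)) = 0) :
    prefixSum g d.next = prefixSum g d + g d.slot := by
  have h1 : ∑ j ∈ Finset.range (d.2.1 + 1),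
      ((relWord N (i d.1))[j]?).elim 0 (fun k => g (Sum.inr d.1, j, k)) =
      prefixSum g d + g d.slot := by
    rw [Finset.sum_range_succ, prefixSum]
    congr 1
    simp [Letter.slot, Letter.label]
  rw [← h1]
  simp only [prefixSum, Letter.next]
  rcases Nat.lt_or_eq_of_le (Nat.succ_le_of_lt d.2.2) with h2 | h2
  · rw [Nat.mod_eq_of_lt h2]
  · rw [← Nat.succ_eq_add_one, h2, Nat.mod_self, h]
    simp

/-- The value of a slot word in the Heisenberg group, first coordinate. -/
theorem heis_slotWord_x (F : Slot S V → Heis) (s : S) :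
    (wordEval (Sum.elim (1 : G →* Heis) F) (slotWord N b i c u (Sum.inl (Sum.inr s)))).x =
      ∑ j ∈ Finset.range (relWord N (i s)).length,
        ((relWord N (i s))[j]?).elim 0 fun k => (F (Sum.inr s, j, k)).x := by
  rw [wordEval_slotWord_cell, MonoidHom.one_apply, inv_one, one_mul, Heis.prod_range_x]
  refine Finset.sum_congr rfl fun j _ => ?_
  cases (relWord N (i s))[j]? <;> simp

theorem heis_slotWord_z (F : Slot S V → Heis) (hF : ∀ y, (F y).z = 0) (s : S) :
    (wordEval (Sum.elim (1 : G →* Heis) F) (slotWord N b i c u (Sum.inl (Sum.inr s)))).z =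
      ∑ l : Fin (relWord N (i s)).length,
        prefixSum (fun y => (F y).x) (⟨s, l⟩ : Letter N i) * (F (Letter.slot ⟨s, l⟩)).y := by
  rw [wordEval_slotWord_cell, MonoidHom.one_apply, inv_one, one_mul, Heis.prod_range_z,
    Finset.sum_range]
  · refine Finset.sum_congr rfl fun l _ => ?_
    rw [prefixSum]
    congr 1
    · refine Finset.sum_congr rfl fun j _ => ?_
      cases (relWord N (i s))[j]? <;> simp
    · simp [Letter.slot, Letter.label]
  · intro j
    cases (relWord N (i s))[j]? <;> simp [hF]

variable [Fintype S]

/-- The intersection numbers modulo `2` of a closed system of arcs vanish: partial sums agree at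
matched letters. -/
theorem prefixSum_matching {W : Word ((A ⊕ S) ⊕ V)}
    {P : List ((G × Slot S V) × (G × Slot S V))} {q : Slot S V → Slot S V}
    {τ : Letter N i → Letter N i}
    (hV : ∀ v, occ v W = 2 ∨ occ v W = 0)
    (hS : ∀ s, letterCount (Sum.inl (Sum.inr s)) W = 1)
    (hP : Paired (unfold 1 (subst (slotWord N b i c u) W)) P)
    (hP₁ : ∀ p ∈ P, p.1.1 = p.2.1)
    (hP₂ : wordEval (Sum.elim id fun _ => 1) (subst (slotWord N b i c u) W) = (1 : G))
    (hq : ∀ p ∈ P, q p.1.2 = q p.2.2) (hτ : ∀ d, τ d ≠ d) (hqτ : ∀ d, q (τ d).slot = q d.slot)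
    (hu : ∀ d d' : Letter N i, q d'.slot = q d.slot → d' = d ∨ d' = τ d)
    (g : Slot S V → ZMod 2)
    (hg : ∀ p ∈ P, g p.1.2 = g p.2.2)
    (h0 : ∀ a ∈ W, ((slotWord N b i c u a.1).map fun l => Sum.elim (fun _ => 0) g l.1).sum = 0)
    (d : Letter N i) : prefixSum g (τ d) = prefixSum g d := by
  classical
  -- The first coordinate carries the cochain `g`, the second is the indicator of the arc through
  -- `d`. Both are constant along arcs, so the identity survives in the Heisenberg group.
  let F : Slot S V → Heis := fun y => ⟨g y, if q y = q d.slot then 1 else 0, 0⟩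
  have h1 : wordEval (fun a => wordEval (Sum.elim (1 : G →* Heis) F)
      (slotWord N b i c u a)) W = 1 := by
    rw [← wordEval_subst]
    refine wordEval_eq_one_of_pairing hP hP₁ hP₂ _ _ fun p hp => ?_
    simp only [F, hq p hp, hg p hp]
  -- By `h0` the first coordinate of every substituted word vanishes, so third coordinates add up;
  -- each variable contributes twice or never, hence zero modulo `2`, and only the relators remain.
  have h2 := Heis.wordEval_z (fun a => wordEval (Sum.elim (1 : G →* Heis) F)
      (slotWord N b i c u a)) W (by
    intro a ha
    rw [Heis.wordEval_x, ← h0 a ha]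
    congr 2
    ext1 ⟨y | y, ε⟩ <;> simp [F])
  rw [h1, sum_letters_eq (fun a => (wordEval (Sum.elim (1 : G →* Heis) F)
      (slotWord N b i c u a)).z) W (by simp [slotWord, wordEval_cons]) hS hV] at h2
  simp only [heis_slotWord_z F (fun _ => rfl)] at h2
  rw [← Fintype.sum_sigma' (fun s l => prefixSum (fun y => (F y).x) (⟨s, l⟩ : Letter N i) *
    (F (Letter.slot ⟨s, l⟩)).y)] at h2
  -- Only `d` and `τ d` lie on the chosen arc.
  have h3 : ∀ e : Letter N i, prefixSum (fun y => (F y).x) e * (F e.slot).y =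
      if e ∈ ({d, τ d} : Finset (Letter N i)) then prefixSum g e else 0 := by
    intro e
    have : q e.slot = q d.slot ↔ e ∈ ({d, τ d} : Finset (Letter N i)) := by
      simp only [Finset.mem_insert, Finset.mem_singleton]
      exact ⟨hu d e, by rintro (rfl | rfl); exacts [rfl, hqτ d]⟩
    simp only [F, this]
    split_ifs <;> simp
  have h4 : ∑ e : Letter N i, prefixSum (fun y => (F y).x) e * (F e.slot).y = 0 := h2.symm
  simp only [h3] at h4
  rw [Finset.sum_ite_mem, Finset.univ_inter, Finset.sum_pair (hτ d).symm,
    CharTwo.add_eq_zero] at h4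
  exact h4.symm

/-- The Euler characteristic bound: a matching without letters in equal places forces the number of
relators to be small. -/
theorem mul_card_le_of_matching {W : Word ((A ⊕ S) ⊕ V)}
    {P : List ((G × Slot S V) × (G × Slot S V))} {q : Slot S V → Slot S V}
    {τ : Letter N i → Letter N i}
    (hV : ∀ v, occ v W = 2 ∨ occ v W = 0)
    (hS : ∀ s, letterCount (Sum.inl (Sum.inr s)) W = 1)
    (hP : Paired (unfold 1 (subst (slotWord N b i c u) W)) P)
    (hP₁ : ∀ p ∈ P, p.1.1 = p.2.1)
    (hP₂ : wordEval (Sum.elim id fun _ => 1) (subst (slotWord N b i c u) W) = (1 : G))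
    (hq : ∀ p ∈ P, q p.1.2 = q p.2.2) (hτℓ : ∀ d, (τ d).label = d.label)
    (hτ : ∀ d, τ d ≠ d) (hqτ : ∀ d, q (τ d).slot = q d.slot)
    (hu : ∀ d d' : Letter N i, q d'.slot = q d.slot → d' = d ∨ d' = τ d)
    (hne : ∀ d, i (τ d).1 = i d.1 → (τ d).2.1 ≠ d.2.1) :
    N * Fintype.card S ≤ 6 * ((vars W).card + Fintype.card S) := by
  classical
  -- `I` is the set of edges and a vector on it is a cochain. `Φ` records its totals over the
  -- variables and the relators, `Ψ` its partial sums at one representative of each vertex in `O`.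
  let I : Finset (Slot S V) := Finset.univ.image fun d : Letter N i => q d.slot
  let g : (I → ZMod 2) → Slot S V → ZMod 2 := fun v y =>
    if h : q y ∈ I then v ⟨q y, h⟩ else 0
  have hg_add : ∀ v w y, g (v + w) y = g v y + g w y := by
    intro v w y
    by_cases h : q y ∈ I <;> simp [g, h]
  let J := {v // v ∈ vars W} ⊕ S
  let word : J → Word (G ⊕ Slot S V) := Sum.elim (fun v => slotWord N b i c u (Sum.inr v.1))
    fun s => slotWord N b i c u (Sum.inl (Sum.inr s))
  let Φ : (I → ZMod 2) →+ (J → ZMod 2) := AddMonoidHom.mk'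
    (fun v j => ((word j).map fun l => Sum.elim (fun _ => 0) (g v) l.1).sum) (by
      intro v w
      ext j
      simp only [Pi.add_apply, ← List.sum_map_add]
      congr 2
      ext1 ⟨y | y, ε⟩ <;> simp [hg_add])
  let O := Quotient (turnSetoid τ (Letter.next : Letter N i → Letter N i))
  let Ψ : (I → ZMod 2) →+ (O → ZMod 2) := AddMonoidHom.mk'
    (fun v o => prefixSum (g v) o.out) (by
      intro v w
      ext o
      simp only [Pi.add_apply, prefixSum, ← Finset.sum_add_distrib]
      refine Finset.sum_congr rfl fun j _ => ?_
      cases (relWord N (i (Quotient.out o).1))[j]? <;> simp [hg_add])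
  have hcard : Fintype.card I ≤ Fintype.card J + Fintype.card O := by
    refine card_le_of_joint_injective Φ Ψ fun v hv hv' => ?_
    have hΦ : ∀ j, ((word j).map fun l => Sum.elim (fun _ => 0) (g v) l.1).sum = 0 :=
      fun j => congrFun hv j
    have h1 : ∀ d : Letter N i, prefixSum (g v) (τ d) = prefixSum (g v) d := by
      refine prefixSum_matching hV hS hP hP₁ hP₂ hq hτ hqτ hu (g v) ?_ ?_
      · intro p hp
        simp only [g, hq p hp]
      · rintro ⟨(a | s) | x, ε⟩ ha
        · simp [slotWord]
        · exact hΦ (Sum.inr s)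
        · exact hΦ (Sum.inl ⟨x, mem_vars.2 ⟨_, ha, rfl⟩⟩)
    have h2 : ∀ d : Letter N i, prefixSum (g v) d.next = prefixSum (g v) d + g v d.slot := by
      intro d
      refine prefixSum_next _ _ ?_
      have h3 := heis_slotWord_x (G := G) (A := A) (N := N) (b := b) (i := i) (c := c) (u := u)
        (fun y : Slot S V => ⟨g v y, 0, 0⟩) d.1
      rw [← h3, Heis.wordEval_x, ← hΦ (Sum.inr d.1)]
      congr 2
      ext1 ⟨y | y, ε⟩ <;> simp
    -- Partial sums descend to vertices: they agree at `d` and `τ d`, and stepping to the next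
    -- letters adds the common value of the arc. If they vanish at all representatives they vanish
    -- everywhere, and so do their increments, the values of `v`.
    have h4 : ∀ d d' : Letter N i, Relation.EqvGen
        (fun a b => b = τ a ∨ ∃ c, a = Letter.next c ∧ b = Letter.next (τ c)) d d' →
        prefixSum (g v) d = prefixSum (g v) d' := by
      intro d d' hdd
      induction hdd with
      | rel a b hab =>
        rcases hab with rfl | ⟨c, rfl, rfl⟩
        · exact (h1 a).symm
        · rw [h2, h2, h1]
          simp only [g, hqτ]
      | refl => rfl
      | symm _ _ _ ih => exact ih.symm
      | trans _ _ _ _ _ ih1 ih2 => exact ih1.trans ih2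
    have h5 : ∀ d : Letter N i, prefixSum (g v) d = 0 := by
      intro d
      rw [← h4 _ _ (Quotient.mk_out (s := turnSetoid τ Letter.next) d)]
      exact congrFun hv' (Quotient.mk (turnSetoid τ Letter.next) d)
    ext ⟨z, hz⟩
    obtain ⟨d, -, rfl⟩ := Finset.mem_image.1 hz
    have h6 := h2 d
    rw [h5, h5, zero_add] at h6
    have h7 : g v d.slot = v ⟨q d.slot, hz⟩ := dif_pos hz
    rw [← h7, ← h6]
    rfl
  -- Each arc has exactly two ends, `d` and `τ d`.
  have hI : Fintype.card (Letter N i) = 2 * Fintype.card I := by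
    rw [Fintype.card_coe, ← Finset.card_univ,
      Finset.card_eq_sum_card_image (fun d : Letter N i => q d.slot),
      Finset.sum_const_nat (m := 2), mul_comm]
    intro z hz
    obtain ⟨d, -, rfl⟩ := Finset.mem_image.1 hz
    refine Eq.trans ?_ (Finset.card_pair (hτ d).symm)
    congr 1
    ext e
    simp only [Finset.mem_filter, Finset.mem_univ, true_and, Finset.mem_insert,
      Finset.mem_singleton]
    exact ⟨hu d e, by rintro (rfl | rfl); exacts [rfl, hqτ d]⟩
  have hnext : Function.Bijective (Letter.next : Letter N i → Letter N i) :=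
    Finite.injective_iff_bijective.1 Letter.next_injective
  have h1 := card_turn_le τ Letter.next hτ hnext
  have h2 := Letter.mul_card_le τ hτℓ hne
  have hJ : Fintype.card J = (vars W).card + Fintype.card S := by
    simp [J]
  have h3 : Fintype.card O =
    Fintype.card (Quotient (turnSetoid τ (Letter.next : Letter N i → Letter N i))) := rfl
  rw [hJ, h3] at hcard
  refine h2.trans ?_
  convert (show _ ≤ 6 * ((vars W).card + Fintype.card S) from ?_) using 1
  -- With `t` the number of turns: `N |S| ≤ t ≤ 3 · 2|I| - 6|O| ≤ 6|J|`.
  rw [hI] at h1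
  omega

/-- A solution, in the free product, of a quadratic equation with few variables and with relators
among its coefficients stays solvable after the cancellation of two relators. -/
theorem exists_cancellation [Nonempty S] {W : Word ((A ⊕ S) ⊕ V)}
    (hV : ∀ v, occ v W = 2 ∨ occ v W = 0)
    (hS : ∀ s, letterCount (Sum.inl (Sum.inr s)) W = 1)
    (hN : 6 * ((vars W).card + Fintype.card S) < N * Fintype.card S) (x : V → FP G (Fin 2))
    (hW : wordEval (Sum.elim (Sum.elim (fun a => Monoid.Coprod.inl (c a))
      fun s => relator N b (i s)) x) W = 1) :
    ∃ (s t : S) (x : V → FP G (Fin 2)), s ≠ t ∧ ∃ ρ : S → FP G (Fin 2), ρ s = 1 ∧ ρ t = 1 ∧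
      (∀ r, r ≠ s → r ≠ t → ρ r = relator N b (i r)) ∧
      wordEval (Sum.elim (Sum.elim (fun a => Monoid.Coprod.inl (c a)) ρ) x) W = 1 := by
  choose u hu using fun v => exists_word (x v)
  obtain rfl : (fun v => wordEval fpLetter (u v)) = x := funext hu
  obtain ⟨P, q, τ, h1, h2, h3, h4, h5, h6, h7, h8, h9⟩ := exists_matching hV hS hW
  by_cases hne : ∀ d, i (τ d).1 = i d.1 → (τ d).2.1 ≠ d.2.1
  · exact absurd (mul_card_le_of_matching hV hS h1 h2 h3 h4 h6 h7 h8 h9 hne) (not_le.2 hN)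
  · push Not at hne
    obtain ⟨d, hd, hd'⟩ := hne
    exact exists_cancelled h1 h2 h3 h4 h5 (h8 d) (h7 d) (h9 d) hd hd'

end Counting

/-! ### Quadratic equations solvable modulo the relators -/

section Core

variable {G A X K : Type*} [Group G] [Group K]

theorem exists_list_of_mem_normalClosure {T : Type*} (r : T → K) {g : K}
    (hg : g ∈ Subgroup.normalClosure (Set.range r)) :
    ∃ L : List (K × T × Bool),
      (L.map fun l => l.1 * cond l.2.2 (r l.2.1) (r l.2.1)⁻¹ * l.1⁻¹).prod = g := by
  rw [Subgroup.normalClosure] at hg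
  induction hg using Subgroup.closure_induction with
  | mem x hx =>
    obtain ⟨_, ⟨t, rfl⟩, hx⟩ := Group.mem_conjugatesOfSet_iff.1 hx
    obtain ⟨z, rfl⟩ := isConj_iff.1 hx
    exact ⟨[(z, t, true)], by simp⟩
  | one => exact ⟨[], by simp⟩
  | mul x y _ _ hx hy =>
    obtain ⟨L, rfl⟩ := hx
    obtain ⟨M, rfl⟩ := hy
    exact ⟨L ++ M, by simp⟩
  | inv x _ hx =>
    obtain ⟨L, rfl⟩ := hx
    refine ⟨(L.map fun l => (l.1, l.2.1, !l.2.2)).reverse, ?_⟩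
    rw [List.prod_inv_reverse, List.map_reverse, List.map_map, List.map_map]
    congr 3
    ext1 ⟨z, t, _ | _⟩ <;> simp [mul_assoc]

theorem prod_map_filter {T : Type*} (L : List T) (p : T → Bool) (f : T → K)
    (h : ∀ t, p t = false → f t = 1) : ((L.filter p).map f).prod = (L.map f).prod := by
  induction L with
  | nil => simp
  | cons t L ih =>
    rcases hp : p t
    · simp [hp, ih, h t hp]
    · simp [hp, ih]

variable {m : ℕ}

/-- The word `W · ∏_s z_s r_s^{ε s} z_s⁻¹`, with `z_s` new variables and `r_s` new coefficients. -/
def conjWord (W : Word (A ⊕ X)) (ε : Fin m → Bool) : Word ((A ⊕ Fin m) ⊕ (X ⊕ Fin m)) :=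
  (W.map fun l => (Sum.map Sum.inl Sum.inl l.1, l.2)) ++
    (List.finRange m).flatMap fun s =>
      [(Sum.inr (Sum.inr s), true), (Sum.inl (Sum.inr s), ε s), (Sum.inr (Sum.inr s), false)]

theorem wordEval_conjWord (W : Word (A ⊕ X)) (ε : Fin m → Bool) (c : A → K) (ρ : Fin m → K)
    (y : X ⊕ Fin m → K) :
    wordEval (Sum.elim (Sum.elim c ρ) y) (conjWord W ε) =
      wordEval (Sum.elim c fun x => y (Sum.inl x)) W *
        ((List.finRange m).map fun s =>
          y (Sum.inr s) * cond (ε s) (ρ s) (ρ s)⁻¹ * (y (Sum.inr s))⁻¹).prod := by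
  rw [conjWord, wordEval_append, wordEval_map]
  congr 1
  · congr 1
    ext1 (a | x) <;> simp
  · induction List.finRange m with
    | nil => simp
    | cons s L ih =>
      rw [List.flatMap_cons, wordEval_append, ih, List.map_cons, List.prod_cons]
      simp [wordEval_cons, mul_assoc]

theorem occ_map_inl (W : Word (A ⊕ X)) (x : X) :
    occ (Sum.inl x : X ⊕ Fin m) (W.map fun l =>
      ((Sum.map Sum.inl Sum.inl l.1 : (A ⊕ Fin m) ⊕ (X ⊕ Fin m)), l.2)) = occ x W := by
  induction W with
  | nil => simp
  | cons l W ih =>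
    obtain ⟨a | x', ε⟩ := l
    · simp [occ_cons, ih]
    · by_cases h : x' = x <;> simp [occ_cons, ih, h]

theorem occ_conjWord_inl (W : Word (A ⊕ X)) (ε : Fin m → Bool) (x : X) :
    occ (Sum.inl x) (conjWord W ε) = occ x W := by
  rw [conjWord, occ_append, occ_map_inl, Nat.add_eq_left]
  induction List.finRange m with
  | nil => simp
  | cons s L ih => simp [occ_cons, ih]

theorem occ_conjWord_inr (W : Word (A ⊕ X)) (ε : Fin m → Bool) (s : Fin m) :
    occ (Sum.inr s) (conjWord W ε) = 2 := by
  have h1 : occ (Sum.inr s : X ⊕ Fin m) (W.map fun l =>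
      ((Sum.map Sum.inl Sum.inl l.1 : (A ⊕ Fin m) ⊕ (X ⊕ Fin m)), l.2)) = 0 := by
    induction W with
    | nil => simp
    | cons l W ih => obtain ⟨a | x', ε⟩ := l <;> simp [occ_cons, ih]
  have h2 : ∀ L : List (Fin m), occ (Sum.inr s : X ⊕ Fin m) (L.flatMap fun s =>
      ([(Sum.inr (Sum.inr s), true), (Sum.inl (Sum.inr s), ε s), (Sum.inr (Sum.inr s), false)] :
        Word ((A ⊕ Fin m) ⊕ (X ⊕ Fin m)))) = 2 * L.count s := by
    intro L
    induction L with
    | nil => simp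
    | cons t L ih =>
      by_cases h : t = s
      · simp [occ_cons, ih, h]
        ring
      · simp [occ_cons, ih, h]
  rw [conjWord, occ_append, h1, h2, List.count_eq_one_of_mem (List.nodup_finRange m)
    (List.mem_finRange s)]

theorem letterCount_conjWord (W : Word (A ⊕ X)) (ε : Fin m → Bool) (s : Fin m) :
    letterCount (Sum.inl (Sum.inr s)) (conjWord W ε) = 1 := by
  have h1 : ∀ L : List (Fin m), letterCount (Sum.inl (Sum.inr s)) (L.flatMap fun s =>
      ([(Sum.inr (Sum.inr s), true), (Sum.inl (Sum.inr s), ε s), (Sum.inr (Sum.inr s), false)] :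
        Word ((A ⊕ Fin m) ⊕ (X ⊕ Fin m)))) = L.count s := by
    intro L
    induction L with
    | nil => simp [letterCount]
    | cons t L ih =>
      rw [letterCount] at ih ⊢
      by_cases h : t = s <;> simp [ih, h]
  have h2 : letterCount (Sum.inl (Sum.inr s)) (W.map fun l =>
      ((Sum.map Sum.inl Sum.inl l.1 : (A ⊕ Fin m) ⊕ (X ⊕ Fin m)), l.2)) = 0 := by
    rw [letterCount, List.countP_eq_zero]
    intro l hl
    obtain ⟨⟨a | x, ε⟩, -, rfl⟩ := List.mem_map.1 hl <;> simp
  have h3 := h1 (List.finRange m)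
  rw [List.count_eq_one_of_mem (List.nodup_finRange m) (List.mem_finRange s)] at h3
  rw [letterCount] at h2 h3 ⊢
  rw [conjWord, List.countP_append, h2, h3]

theorem card_vars_conjWord_le (W : Word (A ⊕ X)) (ε : Fin m → Bool) :
    (vars (conjWord W ε)).card ≤ (vars W).card + m := by
  classical
  have h : vars (conjWord W ε) ⊆ (vars W).disjSum Finset.univ := by
    rintro (x | s) hx
    · rw [Finset.inl_mem_disjSum]
      by_contra hcon
      obtain ⟨l, hl, hl'⟩ := mem_vars.1 hx
      have h1 := occ_eq_zero_of_notMem_vars hcon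
      rw [← occ_conjWord_inl W ε, occ, List.countP_eq_zero] at h1
      exact h1 l hl (by simpa using hl')
    · simp
  refine (Finset.card_le_card h).trans ?_
  simp

/-- A quadratic equation with coefficients in `G` that is solvable modulo the relators is solvable
in `G`. -/
theorem exists_solution_of_mem_normalClosure {N : ℕ} {b : ℕ → G} {c : A → G} {W : Word (A ⊕ X)}
    (hV : ∀ x, occ x W = 2 ∨ occ x W = 0) (hN : 6 * (vars W).card + 13 ≤ N)
    (x : X → FP G (Fin 2))
    (hx : wordEval (Sum.elim (fun a => Monoid.Coprod.inl (c a)) x) W ∈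
      Subgroup.normalClosure (Set.range (relator N b))) :
    ∃ y : X → G, wordEval (Sum.elim c y) W = 1 := by
  obtain ⟨L, hL⟩ := exists_list_of_mem_normalClosure _ (inv_mem hx)
  replace hL : wordEval (Sum.elim (fun a => Monoid.Coprod.inl (c a)) x) W *
      (L.map fun l => l.1 * cond l.2.2 (relator N b l.2.1) (relator N b l.2.1)⁻¹ * l.1⁻¹).prod =
        1 := by
    rw [hL, mul_inv_cancel]
  clear hx
  induction hm : L.length using Nat.strong_induction_on generalizing L x with
  | _ m ih =>
    rcases Nat.eq_zero_or_pos m with rfl | hpos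
    · rw [List.length_eq_zero_iff] at hm
      subst hm
      -- With no relators left, sending `h₁` and `h₂` to `1` retracts the solution to `G`.
      refine ⟨fun v => Monoid.Coprod.fst (x v), ?_⟩
      have h := congrArg Monoid.Coprod.fst hL
      rw [List.map_nil, List.prod_nil, mul_one, map_wordEval, map_one] at h
      refine Eq.trans ?_ h
      congr 1
      ext1 (a | v) <;> simp
    · subst hm
      have : Nonempty (Fin L.length) := ⟨⟨0, hpos⟩⟩
      obtain ⟨s, t, y, hst, ρ, hs, ht, hρ, hW⟩ := exists_cancellation (N := N) (b := b) (c := c)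
        (i := fun s : Fin L.length => L[s].2.1)
        (W := conjWord W fun s : Fin L.length => L[s].2.2)
        (by
          rintro (v | s)
          · rw [occ_conjWord_inl]; exact hV v
          · exact Or.inl (occ_conjWord_inr _ _ _))
        (letterCount_conjWord _ _)
        (by
          -- With `v` variables in `W` and `m = L.length ≥ 1`, the bound to beat is `6 (v + m + m) ≤
          -- 6 v m + 12 m`, which is less than `(6 v + 13) m`.
          have h1 := card_vars_conjWord_le W fun s : Fin L.length => L[s].2.2
          rw [Fintype.card_fin]
          have h2 : (6 * (vars W).card + 13) * L.length ≤ N * L.length :=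
            Nat.mul_le_mul_right _ hN
          have h3 : 6 * (vars W).card * 1 ≤ 6 * (vars W).card * L.length :=
            Nat.mul_le_mul_left _ hpos
          rw [add_mul] at h2
          omega)
        (Sum.elim x fun s => L[s].1)
        (by
          rw [wordEval_conjWord, ← hL]
          congr 2
          exact List.ext_getElem (by simp) fun j h1 h2 => by simp)
      rw [wordEval_conjWord] at hW
      -- The factors of the two trivialized relators are dropped; the others keep their relators,
      -- with new conjugators.
      let p : Fin L.length → Bool := fun r => decide (r ≠ s ∧ r ≠ t)
      refine ih ((List.finRange L.length).filter p).length ?_ (fun v => y (Sum.inl v))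
        (((List.finRange L.length).filter p).map fun r => (y (Sum.inr r), L[r].2)) ?_ (by simp)
      · conv_rhs => rw [← List.length_finRange (n := L.length)]
        exact List.length_filter_lt_length_iff_exists.2 ⟨s, List.mem_finRange s, by simp [p]⟩
      · rw [List.map_map, ← hW, ← prod_map_filter (List.finRange L.length) p]
        · congr 2
          rw [List.map_inj_left]
          intro r hr
          have h1 : r ≠ s ∧ r ≠ t := by simpa [p] using (List.mem_filter.1 hr).2
          simp [hρ r h1.1 h1.2]
        · intro r hr
          have h1 : r = s ∨ r = t := by
            by_contra h2
            push Not at h2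
            simp [p, h2] at hr
          have h2 : ρ r = 1 := by rcases h1 with rfl | rfl <;> assumption
          cases L[r].2.2 <;> simp [h2]

end Core

/-! ### Solutions as assignments of values -/

section Solutions

variable {A X K : Type*} [Group K]

/-- By the universal properties of the coproduct and of the free group, a homomorphism that is the
identity on `K` amounts to a choice of values of the variables. -/
theorem hasSolution_iff {c : A → K} {W : Word (A ⊕ X)} :
    HasSolution c W ↔ ∃ y : X → K, wordEval (Sum.elim c y) W = 1 := by
  constructor
  · rintro ⟨ψ, h1, h2⟩
    refine ⟨fun x => ψ (Monoid.Coprod.inr (FreeGroup.of x)), ?_⟩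
    rw [← h2]
    change _ = ψ (wordEval _ W)
    rw [map_wordEval]
    congr 1
    ext1 (a | x)
    · exact (DFunLike.congr_fun h1 (c a)).symm
    · rfl
  · rintro ⟨y, hy⟩
    refine ⟨Monoid.Coprod.lift (MonoidHom.id K) (FreeGroup.lift y), by simp, ?_⟩
    change Monoid.Coprod.lift (MonoidHom.id K) (FreeGroup.lift y) (wordEval _ W) = _
    rw [map_wordEval, ← hy]
    congr 1
    ext1 (a | x) <;> simp

theorem isSolutionTuple_of_wordEval {S : Set (Word (Fin 2))} {c : A → TwoGenGroup S}
    {W : Word (A ⊕ X)} {U : X → Word (Fin 2)}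
    (h : wordEval (Sum.elim c fun x => hval S (U x)) W = 1) : IsSolutionTuple S c W U := by
  refine ⟨Monoid.Coprod.lift (MonoidHom.id _) (FreeGroup.lift fun x => hval S (U x)),
    ⟨by simp, ?_⟩, by simp⟩
  change Monoid.Coprod.lift (MonoidHom.id _) (FreeGroup.lift fun x => hval S (U x))
    (wordEval _ W) = _
  rw [map_wordEval, ← h]
  congr 1
  ext1 (a | x) <;> simp

theorem hval_eq_wordEval (S : Set (Word (Fin 2))) (w : Word (Fin 2)) :
    hval S w = wordEval (fun k => PresentedGroup.of k) w := by
  rw [hval, ← wordEval_of, map_wordEval]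
  rfl

theorem hval_subst (S : Set (Word (Fin 2))) (s : A → Word (Fin 2)) (L : Word A) :
    hval S (subst s L) = wordEval (fun a => hval S (s a)) L := by
  rw [hval_eq_wordEval, wordEval_subst]
  simp only [hval_eq_wordEval]

theorem hval_eq_one {S : Set (Word (Fin 2))} {w : Word (Fin 2)} (h : w ∈ S) : hval S w = 1 :=
  PresentedGroup.one_of_mem ⟨w, h, rfl⟩

/-- The list of the variables in the order of their occurrence in `W`. -/
def varList (W : Word (A ⊕ X)) : List X := W.filterMap fun a => a.1.getRight?

theorem length_varList (W : Word (A ⊕ X)) : (varList W).length = xLength W := by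
  induction W with
  | nil => simp [varList, xLength]
  | cons a W ih =>
    rw [varList, xLength] at *
    obtain ⟨a | x, ε⟩ := a <;> simp [List.filterMap_cons, List.countP_cons, ih]

theorem mem_varList {x : X} {W : Word (A ⊕ X)} : x ∈ varList W ↔ x ∈ vars W := by
  classical
  simp [varList, vars]

theorem two_mul_card_vars_le {W : Word (A ⊕ X)} (hW : ∀ x, occ x W = 2 ∨ occ x W = 0) :
    2 * (vars W).card ≤ xLength W := by
  classical
  have h1 : (vars W) = (varList W).toFinset := by
    ext x
    rw [List.mem_toFinset, mem_varList]
  rw [← length_varList, ← List.sum_toFinset_count_eq_length, ← h1, mul_comm]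
  refine le_of_eq_of_le (smul_eq_mul _ _).symm (Finset.card_nsmul_le_sum _ _ 2 fun x hx => ?_)
  rw [varList, count_filterMap_getRight?]
  rcases hW x with h | h
  · exact h.ge
  · exfalso
    obtain ⟨a, ha, hax⟩ := mem_vars.1 hx
    rw [occ, List.countP_eq_zero] at h
    exact h a ha (by simpa using hax)

end Solutions

/-! ### The two-generator group and the embedding -/

section Construction

variable {A X G : Type*} [Group G]

theorem exists_hom_of_isPresentation {gen : A → G} {R : Set (Word A)} (h : IsPresentation gen R)
    {K : Type*} [Group K] (f : A → K) (hf : ∀ r ∈ R, wordEval f r = 1) :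
    ∃ μ : G →* K, ∀ a, μ (gen a) = f a := by
  have hker : (FreeGroup.lift gen).ker ≤ (FreeGroup.lift f).ker := by
    rw [h.ker_eq]
    refine Subgroup.normalClosure_le_normal ?_
    rintro _ ⟨r, hr, rfl⟩
    exact hf r hr
  refine ⟨(FreeGroup.lift gen).liftOfSurjective h.surjective ⟨FreeGroup.lift f, hker⟩, fun a => ?_⟩
  have := MonoidHom.liftOfRightInverse_comp_apply (FreeGroup.lift gen) _
    (Function.rightInverse_surjInv h.surjective) ⟨FreeGroup.lift f, hker⟩ (FreeGroup.of a)
  simpa using this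

section VarIdx

variable [Encodable X]

/-- The position of the first occurrence of `x` among the variables of `W`. -/
def varIdx (W : Word (A ⊕ X)) (x : X) : ℕ :=
  ((varList W).map Encodable.encode).idxOf (Encodable.encode x)

theorem varIdx_lt {W : Word (A ⊕ X)} {x : X} (hx : x ∈ vars W) : varIdx W x < xLength W := by
  rw [← length_varList, varIdx]
  have := List.idxOf_lt_length_iff.2
    (List.mem_map_of_mem (f := Encodable.encode) (mem_varList.2 hx))
  simpa using this

theorem varList_getElem?_varIdx {W : Word (A ⊕ X)} {x : X} (hx : x ∈ vars W) :
    (varList W)[varIdx W x]? = some x := by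
  have h := List.idxOf_lt_length_iff.2
    (List.mem_map_of_mem (f := Encodable.encode) (mem_varList.2 hx))
  have h1 := List.getElem_idxOf h
  rw [List.getElem_map] at h1
  rw [List.length_map] at h
  rw [varIdx, List.getElem?_eq_getElem h, Encodable.encode_injective h1]

end VarIdx

/-- The word `∏_{k < N} h₁ h₂^{N i + k + 1}` in `h₁^{±1}`, `h₂^{±1}`. -/
def codeWord (N i : ℕ) : Word (Fin 2) := (relWord N i).map fun k => (k, true)

variable [Encodable A]

/-- The word that represents the generator `a`. -/
def genWord (N : ℕ) (a : A) : Word (Fin 2) := codeWord N (2 * Encodable.encode a)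

variable [Encodable X]

/-- The word that represents the variable `x` of the equation `W` number `p`. -/
def varWord (n N p : ℕ) (W : Word (A ⊕ X)) (x : X) : Word (Fin 2) :=
  codeWord N (2 * (p * n + varIdx W x) + 1)

/-- The defining word of the two-generator group that makes `W`, the equation number `p`,
solvable. -/
def eqWord (n N p : ℕ) (W : Word (A ⊕ X)) : Word (Fin 2) :=
  subst (Sum.elim (genWord N) (varWord n N p W)) W

/-- The defining words of the two-generator group. -/
def defWords (n N : ℕ) (R : Set (Word A)) (e : ℕ → Word (A ⊕ X)) : Set (Word (Fin 2)) :=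
  {w | (∃ r ∈ R, subst (genWord N) r = w) ∨ ∃ p, eqWord n N p (e p) = w}

/-- The element of `G` that the word number `i` has to represent. -/
def codedElement (n : ℕ) (gen : A → G) (e : ℕ → Word (A ⊕ X)) (y : ℕ → X → G) (i : ℕ) : G :=
  if i % 2 = 0 then ((Encodable.decode (i / 2) : Option A)).elim 1 gen
  else ((varList (e (i / 2 / n)))[i / 2 % n]?).elim 1 (y (i / 2 / n))

theorem codedElement_even (n : ℕ) (gen : A → G) (e : ℕ → Word (A ⊕ X)) (y : ℕ → X → G) (a : A) :
    codedElement n gen e y (2 * Encodable.encode a) = gen a := by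
  simp [codedElement]

/-- Each equation owns `n` consecutive odd indices, enough since it has at most `n` occurrences of
variables; quotient and remainder by `n` recover the equation and the variable. Indices that code
nothing get the value `1`. -/
theorem codedElement_odd {n : ℕ} (gen : A → G) {e : ℕ → Word (A ⊕ X)} (y : ℕ → X → G) {p : ℕ}
    (hp : xLength (e p) ≤ n) {x : X} (hx : x ∈ vars (e p)) :
    codedElement n gen e y (2 * (p * n + varIdx (e p) x) + 1) = y p x := by
  have h1 := varIdx_lt hx
  have h2 : varIdx (e p) x < n := by omega
  have h3 : (2 * (p * n + varIdx (e p) x) + 1) / 2 = n * p + varIdx (e p) x := by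
    rw [mul_comm p n]; omega
  have h4 : (2 * (p * n + varIdx (e p) x) + 1) % 2 ≠ 0 := by omega
  have h5 : (n * p + varIdx (e p) x) / n = p := by
    rw [Nat.mul_add_div (by omega), Nat.div_eq_of_lt h2, add_zero]
  have h6 : (n * p + varIdx (e p) x) % n = varIdx (e p) x := by
    rw [Nat.mul_add_mod, Nat.mod_eq_of_lt h2]
  rw [codedElement, if_neg h4, h3, h5, h6, varList_getElem?_varIdx hx]
  rfl

/-- In the quotient of the free product by the relators, code words represent coded elements. -/
theorem mk_inr_codeWord (N : ℕ) (b : ℕ → G) (i : ℕ) :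
    wordEval (fun k => ((Monoid.Coprod.inr (FreeGroup.of k) : FP G (Fin 2)) :
      FP G (Fin 2) ⧸ Subgroup.normalClosure (Set.range (relator N b)))) (codeWord N i) =
      ((Monoid.Coprod.inl (b i) : FP G (Fin 2)) :
        FP G (Fin 2) ⧸ Subgroup.normalClosure (Set.range (relator N b))) := by
  have h1 : ((relator N b i : FP G (Fin 2)) :
      FP G (Fin 2) ⧸ Subgroup.normalClosure (Set.range (relator N b))) = 1 :=
    (QuotientGroup.eq_one_iff _).2 (Subgroup.subset_normalClosure ⟨i, rfl⟩)
  have h2 : ∀ L : List (Fin 2), wordEval (fun k => (Monoid.Coprod.inr (FreeGroup.of k) :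
      FP G (Fin 2))) (L.map fun k => (k, true)) =
      (L.map fun k => (Monoid.Coprod.inr (FreeGroup.of k) : FP G (Fin 2))).prod := by
    intro L
    induction L with
    | nil => simp
    | cons k L ih => rw [List.map_cons, wordEval_cons, ih]; simp
  rw [relator_eq, ← h2, QuotientGroup.mk_mul, QuotientGroup.mk_inv, inv_mul_eq_one] at h1
  rw [h1]
  exact (map_wordEval (QuotientGroup.mk' _) _ _).symm

theorem length_codeWord_le (N i : ℕ) : (codeWord N i).length ≤ N * (N * i + N + 1) := by
  rw [codeWord, List.length_map]
  have : ∀ k ≤ N, blockStart (fun k => N * i + k + 1) k ≤ k * (N * i + N + 1) := by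
    intro k hk
    induction k with
    | zero => simp [blockStart_zero]
    | succ k ih =>
      rw [blockStart_succ, add_mul]
      have := ih (by omega)
      omega
  exact this N le_rfl

/-- Here `N = 3 n + 13 ≤ 10 n` because `n ≥ 2`. An index is at most `2 n (p + 1)` and a code word
has `N` blocks, so its length is at most `400 n³ (p + 1)`; there are at most `n` variables. -/
theorem sum_length_varWord_le {n p : ℕ} (hn : 2 ≤ n) {W : Word (A ⊕ X)}
    (hW : ∀ x, occ x W = 2 ∨ occ x W = 0) (hlen : xLength W ≤ n) :
    ∑ x ∈ vars W, (varWord n (3 * n + 13) p W x).length ≤ 400 * n ^ 4 * (p + 1) := by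
  have h1 : (vars W).card ≤ n := by
    have := two_mul_card_vars_le hW
    omega
  have h2 : ∀ x ∈ vars W, (varWord n (3 * n + 13) p W x).length ≤ 400 * n ^ 3 * (p + 1) := by
    intro x hx
    have hlt := varIdx_lt hx
    refine (length_codeWord_le _ _).trans ?_
    have h3 : 2 * (p * n + varIdx W x) + 1 ≤ 2 * n * (p + 1) := by nlinarith
    have h4 : 3 * n + 13 ≤ 10 * n := by omega
    have h5 : (3 * n + 13) * (2 * (p * n + varIdx W x) + 1) ≤ 10 * n * (2 * n * (p + 1)) :=
      Nat.mul_le_mul h4 h3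
    have h6 : 3 * n + 13 + 1 ≤ 10 * n * (2 * n * (p + 1)) := by nlinarith [Nat.zero_le (n * n * p)]
    calc (3 * n + 13) * ((3 * n + 13) * (2 * (p * n + varIdx W x) + 1) + (3 * n + 13) + 1)
        ≤ 10 * n * (10 * n * (2 * n * (p + 1)) + 10 * n * (2 * n * (p + 1))) :=
          Nat.mul_le_mul h4 (by omega)
      _ = 400 * n ^ 3 * (p + 1) := by ring
  calc ∑ x ∈ vars W, (varWord n (3 * n + 13) p W x).length
      ≤ (vars W).card * (400 * n ^ 3 * (p + 1)) := by
        simpa using Finset.sum_le_card_nsmul _ _ _ h2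
    _ ≤ n * (400 * n ^ 3 * (p + 1)) := Nat.mul_le_mul_right _ h1
    _ = 400 * n ^ 4 * (p + 1) := by ring

/-- The embedding into the two-generator group, without the statements on computability. -/
theorem exists_embedding {n : ℕ} (hn : 2 ≤ n) {gen : A → G} {R : Set (Word A)}
    (hR : IsPresentation gen R) {e : ℕ → Word (A ⊕ X)} (he : IsEnumeration n gen e) :
    ∃ μ : G →* TwoGenGroup (defWords n (3 * n + 13) R e),
      (∀ a, μ (gen a) = hval _ (genWord (3 * n + 13) a)) ∧ PreservesQuadratic X n gen μ ∧
      HasShortSolutions 400 n gen e _ μ := by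
  -- A quadratic equation of length at most `n` has at most `n / 2` variables, so this `N` is at
  -- least `6 · |vars| + 13`.
  set N := 3 * n + 13 with hN
  set S := defWords n N R e with hS
  have hep : ∀ p, IsQuadratic (e p) ∧ xLength (e p) ≤ n ∧ HasSolution gen (e p) := fun p =>
    (Set.ext_iff.1 he (e p)).1 ⟨p, rfl⟩
  choose y hy using fun p => hasSolution_iff.1 (hep p).2.2
  obtain ⟨μ, hμ⟩ := exists_hom_of_isPresentation hR (fun a => hval S (genWord N a)) (by
    intro r hr
    rw [← hval_subst]
    exact hval_eq_one (Or.inl ⟨r, hr, rfl⟩))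
  let b := codedElement n gen e y
  let Q := FP G (Fin 2) ⧸ Subgroup.normalClosure (Set.range (relator N b))
  let ι : G →* Q := (QuotientGroup.mk' _).comp Monoid.Coprod.inl
  let k₀ : Fin 2 → Q := fun k => ((Monoid.Coprod.inr (FreeGroup.of k) : FP G (Fin 2)) : Q)
  have hgen : ∀ a, wordEval k₀ (genWord N a) = ι (gen a) := by
    intro a
    rw [genWord, mk_inr_codeWord, ← codedElement_even n gen e y]
    rfl
  -- In `Q` code words equal the elements they code, so the defining words of `H` become relations
  -- of `G` and solved equations. No isomorphism of `H` with `Q` is needed.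
  let η : TwoGenGroup S →* Q := PresentedGroup.toGroup (f := k₀) (by
    rintro _ ⟨w, hw, rfl⟩
    change wordEval k₀ w = 1
    rcases hw with ⟨r, hr, rfl⟩ | ⟨p, rfl⟩
    · rw [wordEval_subst]
      simp only [hgen]
      rw [← map_wordEval]
      have : FreeGroup.mk r ∈ (FreeGroup.lift gen).ker := by
        rw [hR.ker_eq]
        exact Subgroup.subset_normalClosure ⟨r, hr, rfl⟩
      rw [wordEval, MonoidHom.mem_ker.1 this, map_one]
    · rw [eqWord, wordEval_subst, ← map_one ι, ← hy p, map_wordEval]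
      refine wordEval_congr ?_
      rintro ⟨a | x, ε⟩ ha
      · exact hgen a
      · simp only [Sum.elim_inr]
        rw [varWord, mk_inr_codeWord]
        rw [← codedElement_odd gen y (hep p).2.1 (mem_vars.2 ⟨_, ha, rfl⟩)]
        rfl)
  have hη : ∀ w, η (hval S w) = wordEval k₀ w := fun w => by
    rw [hval_eq_wordEval, map_wordEval]
    congr 1
  have hημ : ∀ g, η (μ g) = ι g := by
    intro g
    obtain ⟨z, rfl⟩ := hR.surjective g
    obtain ⟨L, rfl⟩ := Quot.exists_rep z
    change η (μ (wordEval gen L)) = ι (wordEval gen L)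
    rw [map_wordEval, map_wordEval, map_wordEval]
    simp only [hμ, hη, hgen]
  refine ⟨μ, hμ, ⟨?_, ?_⟩, ?_⟩
  · rw [injective_iff_map_eq_one]
    intro g hg
    have h1 : (Monoid.Coprod.inl g : FP G (Fin 2)) ∈
        Subgroup.normalClosure (Set.range (relator N b)) := by
      rw [← QuotientGroup.eq_one_iff]
      change ι g = 1
      rw [← hημ, hg, map_one]
    -- An element of the kernel is treated as an equation `g = 1` without variables.
    obtain ⟨_, hy'⟩ := exists_solution_of_mem_normalClosure (N := N) (b := b) (c := (id : G → G))
      (W := ([(Sum.inl g, true)] : Word (G ⊕ Empty))) (by rintro ⟨⟩)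
      (by simp [vars, List.filterMap_cons, hN]) (fun x => x.elim) (by simpa [wordEval_cons] using h1)
    simpa [wordEval_cons] using hy'
  · intro W hW hlen
    rw [hasSolution_iff, hasSolution_iff]
    constructor
    · rintro ⟨z, hz⟩
      refine ⟨fun x => μ (z x), ?_⟩
      rw [← map_one μ, ← hz, map_wordEval]
      congr 1
      ext1 (a | x) <;> simp
    · rintro ⟨z, hz⟩
      -- A solution in `H` is pushed to `Q` and lifted to the free product, where the equation holds
      -- modulo the relators.
      choose x hx using fun v => QuotientGroup.mk'_surjective
        (Subgroup.normalClosure (Set.range (relator N b))) (η (z v))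
      refine exists_solution_of_mem_normalClosure (N := N) (b := b) hW.2 ?_ x ?_
      · have := two_mul_card_vars_le hW.2
        omega
      · rw [← QuotientGroup.eq_one_iff]
        change QuotientGroup.mk' _ (wordEval _ W) = 1
        rw [map_wordEval, ← map_one η, ← hz, map_wordEval]
        congr 1
        ext1 (a | v)
        · exact (hημ (gen a)).symm
        · exact hx v
  · intro p
    refine ⟨varWord n N p (e p), isSolutionTuple_of_wordEval ?_, ?_⟩
    · have h1 : hval S (eqWord n N p (e p)) = 1 := hval_eq_one (Or.inr ⟨p, rfl⟩)
      rw [eqWord, hval_subst] at h1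
      rw [← h1]
      congr 1
      ext1 (a | x) <;> simp [hμ]
    · have := sum_length_varWord_le (p := p) hn (hep p).1.2 (hep p).2.1
      rw [tupleLength]
      exact_mod_cast this

end Construction

theorem length_subst {α β : Type*} (s : α → Word β) (L : Word α) :
    (subst s L).length = (L.map fun a => (s a.1).length).sum := by
  induction L with
  | nil => simp
  | cons a L ih => rcases a with ⟨a, _ | _⟩ <;> simp [subst_cons, ih]

theorem length_le_length_subst {α β : Type*} {s : α → Word β} {L : Word α} {a : α × Bool} (ha : a ∈ L) :
    (s a.1).length ≤ (subst s L).length := by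
  rw [length_subst]
  exact List.single_le_sum (by simp) _ (List.mem_map.2 ⟨a, ha, rfl⟩)

/-! ### Primitive recursive building blocks and length bounds -/

section General

variable {α β γ σ : Type*} [Primcodable α] [Primcodable β] [Primcodable γ] [Primcodable σ]

theorem computable_any_range {f : α → ℕ} {g : α → ℕ → Bool} (hf : Computable f)
    (hg : Computable₂ g) : Computable fun a => (List.range (f a)).any (g a) := by
  refine (Computable.nat_rec (g := fun _ => false) (h := fun a p => p.2 || g a p.1) hf
    (Computable.const false) ?_).of_eq fun a => ?_
  · exact (Primrec.or.to_comp.comp (Computable.snd.comp Computable.snd)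
      (hg.comp Computable.fst (Computable.fst.comp Computable.snd)) :)
  · induction f a with
    | zero => simp
    | succ n ih => simp [List.range_succ, ih]

theorem rePred_of_exists {p : α → Prop} {g : α → ℕ → Bool} (hg : Computable₂ g)
    (h : ∀ a, p a ↔ ∃ k, g a k = true) : REPred p := by
  have h1 : Partrec fun a => Nat.rfind fun k => (Part.some (g a k) : Part Bool) :=
    Partrec.rfind hg.partrec₂
  refine h1.dom_re.of_eq fun a => ?_
  refine Nat.rfind_dom.trans (Iff.trans ?_ (h a).symm)
  constructor
  · rintro ⟨k, hk, -⟩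
    exact ⟨k, by simpa [Part.mem_some_iff] using hk⟩
  · rintro ⟨k, hk⟩
    exact ⟨k, by simpa [Part.mem_some_iff] using hk, fun _ => trivial⟩

/-- The stage `k` is a bound for the evaluation of a code that semidecides `p`; bounded evaluation
is primitive recursive. -/
theorem exists_stages {p : α → Prop} (hp : REPred p) :
    ∃ g : α → ℕ → Bool, Primrec₂ g ∧ ∀ a, p a ↔ ∃ k, g a k = true := by
  obtain ⟨c, hc⟩ := Nat.Partrec.Code.exists_code.1 hp
  refine ⟨fun a k => (Nat.Partrec.Code.evaln k c (Encodable.encode a)).isSome, ?_, fun a => ?_⟩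
  · exact Primrec.option_isSome.comp (Nat.Partrec.Code.primrec_evaln.comp
      ((Primrec.snd.pair (Primrec.const c)).pair (Primrec.encode.comp Primrec.fst)))
  · have h1 : p a ↔ (Nat.Partrec.Code.eval c (Encodable.encode a)).Dom := by
      rw [hc]
      simp [Part.assert, Part.bind]
    rw [h1, Part.dom_iff_mem]
    simp only [Nat.Partrec.Code.evaln_complete, Option.isSome_iff_exists, Option.mem_def]
    exact exists_comm

theorem primrec_invRev : Primrec (FreeGroup.invRev : Word α → Word α) :=
  Primrec.list_reverse.comp (Primrec.list_map Primrec.id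
    ((Primrec.fst.comp Primrec.snd).pair (Primrec.not.comp (Primrec.snd.comp Primrec.snd))).to₂)

theorem primrec_subst {s : γ → α → Word β} {L : γ → Word α} (hs : Primrec₂ s) (hL : Primrec L) :
    Primrec fun c => subst (s c) (L c) := by
  refine Primrec.list_flatMap hL ?_
  have h : Primrec fun x : γ × (α × Bool) => s x.1 x.2.1 :=
    hs.comp Primrec.fst (Primrec.fst.comp Primrec.snd)
  exact (Primrec.cond (Primrec.snd.comp Primrec.snd) h (primrec_invRev.comp h) :)

theorem primrec_varList : Primrec (varList : Word (α ⊕ β) → List β) := by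
  refine Primrec.listFilterMap Primrec.id ?_
  have : Primrec fun x : Word (α ⊕ β) × ((α ⊕ β) × Bool) =>
      (Sum.casesOn x.2.1 (fun _ => none) some : Option β) :=
    Primrec.sumCasesOn (Primrec.fst.comp Primrec.snd) (Primrec.const none).to₂
      (Primrec.option_some.comp Primrec.snd).to₂
  exact this.of_eq fun x => by rcases x with ⟨_, a | b, _⟩ <;> rfl

theorem primrec_varIdx : Primrec₂ (varIdx : Word (α ⊕ β) → β → ℕ) :=
  Primrec.list_idxOf.comp (Primrec.encode.comp Primrec.snd)
    (Primrec.list_map (primrec_varList.comp Primrec.fst) (Primrec.encode.comp Primrec.snd).to₂)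

theorem primrec_codeWord (N : ℕ) : Primrec (codeWord N) := by
  have h1 : Primrec (relWord N) := by
    refine Primrec.list_flatMap (Primrec.const (List.range N)) ?_
    refine Primrec.list_cons.comp (Primrec.const 0) ?_
    have h2 : Primrec fun x : ℕ × ℕ => N * x.1 + x.2 + 1 :=
      Primrec.succ.comp (Primrec.nat_add.comp
        (Primrec.nat_mul.comp (Primrec.const N) Primrec.fst) Primrec.snd)
    have h3 : Primrec fun x : ℕ × ℕ =>
        (List.range (N * x.1 + x.2 + 1)).map fun _ => (1 : Fin 2) :=
      Primrec.list_map (Primrec.list_range.comp h2) (Primrec.const 1).to₂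
    exact h3.of_eq fun x => by simp
  exact Primrec.list_map h1 (Primrec.snd.pair (Primrec.const true)).to₂

theorem primrec_genWord (N : ℕ) : Primrec (genWord N : α → Word (Fin 2)) :=
  (primrec_codeWord N).comp (Primrec.nat_mul.comp (Primrec.const 2) Primrec.encode)

theorem primrec_subst_genWord (N : ℕ) :
    Primrec (subst (genWord N) : Word α → Word (Fin 2)) :=
  primrec_subst ((primrec_genWord N).comp Primrec.snd).to₂ Primrec.id

theorem primrec_eqWord (n N : ℕ) :
    Primrec₂ (eqWord n N : ℕ → Word (α ⊕ β) → Word (Fin 2)) := by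
  refine primrec_subst (γ := ℕ × Word (α ⊕ β)) ?_ Primrec.snd
  have h1 : Primrec fun x : ((ℕ × Word (α ⊕ β)) × (α ⊕ β)) × β =>
      varWord n N x.1.1.1 x.1.1.2 x.2 := by
    refine (primrec_codeWord N).comp (Primrec.succ.comp
      (Primrec.nat_mul.comp (Primrec.const 2) (Primrec.nat_add.comp
        (Primrec.nat_mul.comp (Primrec.fst.comp (Primrec.fst.comp Primrec.fst)) (Primrec.const n))
        (primrec_varIdx.comp (Primrec.snd.comp (Primrec.fst.comp Primrec.fst)) Primrec.snd))))
  have h2 : Primrec fun x : (ℕ × Word (α ⊕ β)) × (α ⊕ β) =>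
      (Sum.casesOn x.2 (fun a => genWord N a) (fun y => varWord n N x.1.1 x.1.2 y) :
        Word (Fin 2)) :=
    Primrec.sumCasesOn Primrec.snd ((primrec_genWord N).comp Primrec.snd).to₂ h1.to₂
  exact h2.of_eq fun x => by rcases x with ⟨_, a | b⟩ <;> rfl

/-- A bound for the codes of the words of length at most `k` in the letters with codes at most
`l`. -/
def codeBound (l k : ℕ) : ℕ :=
  Nat.rec 0 (fun _ m => Nat.succ (Nat.pair (Nat.pair l 1) m)) k

theorem primrec_codeBound : Primrec₂ codeBound :=
  Primrec.nat_rec (Primrec.const 0) (Primrec.succ.comp (Primrec₂.natPair.comp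
    (Primrec₂.natPair.comp Primrec.fst (Primrec.const 1)) (Primrec.snd.comp Primrec.snd))).to₂

theorem natPair_le_natPair {a b c d : ℕ} (h1 : a ≤ c) (h2 : b ≤ d) :
    Nat.pair a b ≤ Nat.pair c d := by
  have h3 : Nat.pair a b ≤ Nat.pair c b := by
    rcases h1.lt_or_eq with h | rfl
    · exact (Nat.pair_lt_pair_left b h).le
    · exact le_rfl
  have h4 : Nat.pair c b ≤ Nat.pair c d := by
    rcases h2.lt_or_eq with h | rfl
    · exact (Nat.pair_lt_pair_right c h).le
    · exact le_rfl
  exact h3.trans h4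

theorem encode_le_codeBound {l k : ℕ} {w : Word α} (hk : w.length ≤ k)
    (hl : ∀ a ∈ w, Encodable.encode a.1 ≤ l) : Encodable.encode w ≤ codeBound l k := by
  induction w generalizing k with
  | nil => simp
  | cons a w ih =>
    cases k with
    | zero => simp at hk
    | succ k =>
      rw [Encodable.encode_list_cons]
      refine Nat.succ_le_succ (natPair_le_natPair ?_ (ih (by simpa using hk)
        fun b hb => hl b (by simp [hb])))
      obtain ⟨a, ε⟩ := a
      rw [Encodable.encode_prod_val]
      refine natPair_le_natPair (hl (a, ε) (by simp)) ?_
      cases ε <;> simp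

theorem le_length_codeWord {N : ℕ} (hN : 0 < N) (i : ℕ) : i + 1 ≤ (codeWord N i).length := by
  have h1 := (blockStart_strictMono fun k => N * i + k + 1).monotone (Nat.succ_le_of_lt hN)
  rw [Nat.succ_eq_add_one, blockStart_succ, blockStart_zero] at h1
  have h2 : i ≤ N * i := Nat.le_mul_of_pos_left i hN
  have h3 : (codeWord N i).length = blockStart (fun k => N * i + k + 1) N := by
    rw [codeWord, List.length_map]
    rfl
  omega

/-- The code word of a generator is longer than the number of the generator and is never empty. The
image of `r` therefore bounds both the length of `r` and the numbers of its letters, and only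
finitely many `r` need be tried. -/
theorem encode_le_of_subst_genWord {N : ℕ} (hN : 0 < N) (r : Word α) :
    Encodable.encode r ≤ codeBound (subst (genWord N) r).length (subst (genWord N) r).length := by
  refine encode_le_codeBound ?_ fun a ha => ?_
  · rw [length_subst]
    have : r.length = (r.map fun _ => 1).sum := by simp
    rw [this]
    refine List.sum_le_sum fun a _ => ?_
    have := le_length_codeWord hN (2 * Encodable.encode a.1)
    rw [genWord]
    omega
  · have h1 := length_le_length_subst (s := genWord N) ha
    have h2 := le_length_codeWord hN (2 * Encodable.encode a.1)
    rw [genWord] at h1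
    omega

/-- An equation contains a variable, whose code word has index at least `p`. -/
theorem le_length_eqWord {n N : ℕ} (hn : 0 < n) (hN : 0 < N) (p : ℕ) {W : Word (α ⊕ β)}
    (hW : 0 < xLength W) : p < (eqWord n N p W).length := by
  rw [xLength, List.countP_pos_iff] at hW
  obtain ⟨⟨a | x, ε⟩, ha, hx⟩ := hW
  · simp at hx
  · have h1 := length_le_length_subst (s := Sum.elim (genWord N) (varWord n N p W)) ha
    rw [Sum.elim_inr, varWord] at h1
    have h2 := le_length_codeWord hN (2 * (p * n + varIdx W x) + 1)
    have h3 : p ≤ p * n := Nat.le_mul_of_pos_right p hn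
    rw [eqWord]
    omega

end General

/-! ### Enumerability and decidability of the defining words -/

section DefWords

variable {A X : Type*} [Primcodable A] [Primcodable X]

/-- A witness is either a word with a stage confirming it as a relator of `G`, or the number of an
equation; witnesses are searched through their codes. -/
theorem rePred_defWords (n N : ℕ) {R : Set (Word A)} {e : ℕ → Word (A ⊕ X)} (he : Computable e)
    (hR : REPred fun w => w ∈ R) : REPred fun w => w ∈ defWords n N R e := by
  obtain ⟨g, hg, hgR⟩ := exists_stages hR
  have h1 : Computable fun x : ((Word (Fin 2) × ℕ) × ((Word A × ℕ) ⊕ ℕ)) × (Word A × ℕ) =>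
      (g x.2.1 x.2.2 && decide (subst (genWord N) x.2.1 = x.1.1.1)) :=
    (Primrec.and.comp (hg.comp (Primrec.fst.comp Primrec.snd) (Primrec.snd.comp Primrec.snd))
      (Primrec.eq.decide.comp ((primrec_subst_genWord N).comp (Primrec.fst.comp Primrec.snd))
        (Primrec.fst.comp (Primrec.fst.comp Primrec.fst)))).to_comp
  have h2 : Computable fun x : ((Word (Fin 2) × ℕ) × ((Word A × ℕ) ⊕ ℕ)) × ℕ =>
      decide (eqWord n N x.2 (e x.2) = x.1.1.1) :=
    Primrec.eq.decide.to_comp.comp ((primrec_eqWord n N).to_comp.comp Computable.snd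
      (he.comp Computable.snd)) (Computable.fst.comp (Computable.fst.comp Computable.fst))
  have h3 : Computable fun x : (Word (Fin 2) × ℕ) × ((Word A × ℕ) ⊕ ℕ) =>
      (Sum.casesOn x.2 (fun y => g y.1 y.2 && decide (subst (genWord N) y.1 = x.1.1))
        (fun p => decide (eqWord n N p (e p) = x.1.1)) : Bool) :=
    Computable.sumCasesOn Computable.snd h1.to₂ h2.to₂
  have h4 : Computable fun x : Word (Fin 2) × ℕ =>
      (Option.casesOn (Encodable.decode x.2 : Option ((Word A × ℕ) ⊕ ℕ)) false
        (fun t => Sum.casesOn t (fun y => g y.1 y.2 && decide (subst (genWord N) y.1 = x.1))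
          (fun p => decide (eqWord n N p (e p) = x.1))) : Bool) :=
    Computable.option_casesOn (Computable.decode.comp Computable.snd) (Computable.const false)
      h3.to₂
  refine rePred_of_exists h4.to₂ fun w => ?_
  constructor
  · rintro (⟨r, hr, rfl⟩ | ⟨p, rfl⟩)
    · obtain ⟨k, hk⟩ := (hgR r).1 hr
      exact ⟨Encodable.encode (Sum.inl (r, k) : (Word A × ℕ) ⊕ ℕ), by
        simp only [Encodable.encodek]; simp [hk]⟩
    · exact ⟨Encodable.encode (Sum.inr p : (Word A × ℕ) ⊕ ℕ), by
        simp only [Encodable.encodek]; simp⟩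
  · rintro ⟨k, hk⟩
    rcases h : (Encodable.decode k : Option ((Word A × ℕ) ⊕ ℕ)) with _ | (⟨r, j⟩ | p)
    · rw [h] at hk
      simp at hk
    · rw [h] at hk
      simp only [Bool.and_eq_true, decide_eq_true_eq] at hk
      exact Or.inl ⟨r, (hgR r).2 ⟨j, hk.1⟩, hk.2⟩
    · rw [h] at hk
      simp only [decide_eq_true_eq] at hk
      exact Or.inr ⟨p, hk⟩

/-- The length of `w` bounds both the code of a relator and the number of an equation that could
produce `w`, so both existential quantifiers become finite searches. -/
theorem computablePred_defWords {n N : ℕ} (hn : 0 < n) (hN : 0 < N) {R : Set (Word A)}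
    {e : ℕ → Word (A ⊕ X)} (he : Computable e) (hpos : ∀ p, 0 < xLength (e p))
    (hR : ComputablePred fun w => w ∈ R) : ComputablePred fun w => w ∈ defWords n N R e := by
  obtain ⟨f, hf, hfR⟩ := ComputablePred.computable_iff.1 hR
  have hfR' : ∀ r, r ∈ R ↔ f r = true := fun r => iff_of_eq (congrFun hfR r)
  have h1 : Computable fun x : (Word (Fin 2) × ℕ) × Word A =>
      (f x.2 && decide (subst (genWord N) x.2 = x.1.1)) :=
    Primrec.and.to_comp.comp (hf.comp Computable.snd)
      (Primrec.eq.decide.comp ((primrec_subst_genWord N).comp Primrec.snd)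
        (Primrec.fst.comp Primrec.fst)).to_comp
  have h2 : Computable fun x : Word (Fin 2) × ℕ =>
      (Option.casesOn (Encodable.decode x.2 : Option (Word A)) false
        (fun r => f r && decide (subst (genWord N) r = x.1)) : Bool) :=
    Computable.option_casesOn (Computable.decode.comp Computable.snd) (Computable.const false)
      h1.to₂
  have h3 : Computable fun x : Word (Fin 2) × ℕ => decide (eqWord n N x.2 (e x.2) = x.1) :=
    Primrec.eq.decide.to_comp.comp ((primrec_eqWord n N).to_comp.comp Computable.snd
      (he.comp Computable.snd)) Computable.fst
  have hlen : Primrec (List.length : Word (Fin 2) → ℕ) := Primrec.list_length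
  have h4 := Primrec.or.to_comp.comp
    (computable_any_range (Primrec.succ.comp (primrec_codeBound.comp hlen hlen)).to_comp h2.to₂)
    (computable_any_range hlen.to_comp h3.to₂)
  refine ComputablePred.computable_iff.2 ⟨_, h4, ?_⟩
  ext w
  simp only [Bool.or_eq_true, List.any_eq_true, List.mem_range, decide_eq_true_eq]
  refine or_congr ?_ ?_
  · constructor
    · rintro ⟨r, hr, rfl⟩
      refine ⟨Encodable.encode r, Nat.lt_succ_of_le (encode_le_of_subst_genWord hN r), ?_⟩
      simp [(hfR' r).1 hr]
    · rintro ⟨k, -, hk⟩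
      rcases h : (Encodable.decode k : Option (Word A)) with _ | r
      · rw [h] at hk
        simp at hk
      · rw [h] at hk
        simp only [Bool.and_eq_true, decide_eq_true_eq] at hk
        exact ⟨r, (hfR' r).2 hk.1, hk.2⟩
  · constructor
    · rintro ⟨p, rfl⟩
      exact ⟨p, le_length_eqWord hn hN p (hpos p), rfl⟩
    · rintro ⟨p, -, hp⟩
      exact ⟨p, hp⟩

end DefWords

/-! ### Deciding free and cyclic reduction -/

section Reduce

variable {α β : Type*} [Primcodable α] [Primcodable β]

theorem primrec_reduce [DecidableEq α] : Primrec (FreeGroup.reduce : Word α → Word α) := by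
  have h1 : PrimrecPred fun x : ((Word α × ((α × Bool) × Word α × Word α)) ×
      ((α × Bool) × Word α)) => x.1.2.1.1 = x.2.1.1 ∧ x.1.2.1.2 = !x.2.1.2 := by
    have h2 : Primrec fun x : ((Word α × ((α × Bool) × Word α × Word α)) ×
        ((α × Bool) × Word α)) => x.1.2.1 :=
      Primrec.fst.comp (Primrec.snd.comp Primrec.fst)
    have h3 : Primrec fun x : ((Word α × ((α × Bool) × Word α × Word α)) ×
        ((α × Bool) × Word α)) => x.2.1 := Primrec.fst.comp Primrec.snd
    exact (Primrec.eq.comp (Primrec.fst.comp h2) (Primrec.fst.comp h3)).and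
      (Primrec.eq.comp (Primrec.snd.comp h2) (Primrec.not.comp (Primrec.snd.comp h3)))
  have h4 : Primrec fun x : (Word α × ((α × Bool) × Word α × Word α)) × ((α × Bool) × Word α) =>
      x.1.2.1 :: x.2.1 :: x.2.2 :=
    Primrec.list_cons.comp (Primrec.fst.comp (Primrec.snd.comp Primrec.fst))
      (Primrec.list_cons.comp (Primrec.fst.comp Primrec.snd) (Primrec.snd.comp Primrec.snd))
  have h5 : Primrec fun x : Word α × ((α × Bool) × Word α × Word α) =>
      (List.casesOn x.2.2.2 [x.2.1] fun b l =>
        if x.2.1.1 = b.1 ∧ x.2.1.2 = !b.2 then l else x.2.1 :: b :: l : Word α) :=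
    Primrec.list_casesOn (Primrec.snd.comp (Primrec.snd.comp Primrec.snd))
      (Primrec.list_cons.comp (Primrec.fst.comp Primrec.snd) (Primrec.const []))
      (Primrec.ite h1 (Primrec.snd.comp Primrec.snd) h4).to₂
  refine (Primrec.list_rec Primrec.id (Primrec.const []) h5.to₂).of_eq fun L => ?_
  rfl

/-- The junction in `W ++ W` is precisely where the last letter of `W` meets its first one. -/
theorem isCyclicallyReduced_iff_reduce {α : Type*} [DecidableEq α] (W : Word α) :
    FreeGroup.IsCyclicallyReduced W ↔ FreeGroup.reduce (W ++ W) = W ++ W := by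
  rw [← FreeGroup.isReduced_iff_reduce_eq, FreeGroup.IsReduced, List.isChain_append,
    FreeGroup.IsCyclicallyReduced, FreeGroup.IsReduced]
  tauto

end Reduce

/-! ### Enumerating the solvable equations -/

section Certificates

variable {A X : Type*}

/-- The product of the words `z r^{±1} z⁻¹` for the members `(z, r, ±, k)` of the list. -/
def consequence (L : List (Word A × Word A × Bool × ℕ)) : Word A :=
  L.flatMap fun l => l.1 ++ (cond l.2.2.1 l.2.1 (FreeGroup.invRev l.2.1) ++ FreeGroup.invRev l.1)

theorem wordEval_consequence {K : Type*} [Group K] (f : A → K)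
    (L : List (Word A × Word A × Bool × ℕ)) :
    wordEval f (consequence L) = (L.map fun l => wordEval f l.1 *
      cond l.2.2.1 (wordEval f l.2.1) (wordEval f l.2.1)⁻¹ * (wordEval f l.1)⁻¹).prod := by
  induction L with
  | nil => simp [consequence]
  | cons l L ih =>
    rw [consequence] at ih ⊢
    rcases l with ⟨z, r, _ | _, k⟩ <;>
      simp [wordEval_append, wordEval_invRev, ih, mul_assoc]

/-- A form that can be checked: the quantifier over all variables is replaced by one over the finite
list of variables that occur. -/
theorem isQuadratic_iff [DecidableEq A] [DecidableEq X] {W : Word (A ⊕ X)} :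
    IsQuadratic W ↔ FreeGroup.reduce (W ++ W) = W ++ W ∧ 0 < (varList W).length ∧
      ∀ x ∈ varList W, ((varList W).filter fun y => y = x).length = 2 := by
  have h : ∀ x, ((varList W).filter fun y => y = x).length = occ x W := by
    intro x
    rw [← count_filterMap_getRight? x W, ← varList, List.count, List.countP_eq_length_filter]
    rfl
  simp only [IsQuadratic, IsEquation, isCyclicallyReduced_iff_reduce, length_varList, and_assoc, h]
  refine and_congr_right fun _ => and_congr_right fun _ => forall_congr' fun x => ?_
  constructor
  · intro h1 hx
    refine h1.resolve_right fun h2 => ?_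
    rw [← count_filterMap_getRight? x W, ← varList, List.count_eq_zero] at h2
    exact h2 hx
  · intro h1
    by_cases hx : x ∈ varList W
    · exact Or.inl (h1 hx)
    · exact Or.inr (occ_eq_zero_of_notMem_vars (mt mem_varList.2 hx))

theorem isQuadratic_square (x : X) :
    IsQuadratic ([(Sum.inr x, true), (Sum.inr x, true)] : Word (A ⊕ X)) := by
  refine ⟨⟨by simp [FreeGroup.isCyclicallyReduced_iff, FreeGroup.IsReduced], by simp [xLength]⟩,
    fun y => ?_⟩
  by_cases h : x = y <;> simp [occ, h]

variable [Primcodable A] [Primcodable X]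

open Classical in
/-- `(W, V, L)` certifies that `W = 1` is a quadratic equation of length at most `n` for which the
tuple `V` of words is a solution, by means of the product `L` of conjugates of the defining words
that are listed in the stages `g`. -/
def IsCertificate (n : ℕ) (g : Word A → ℕ → Bool)
    (c : Word (A ⊕ X) × List (Word A) × List (Word A × Word A × Bool × ℕ)) : Prop :=
  (FreeGroup.reduce (c.1 ++ c.1) = c.1 ++ c.1 ∧ 0 < (varList c.1).length ∧
    ∀ x ∈ varList c.1, ((varList c.1).filter fun y => y = x).length = 2) ∧
  (varList c.1).length ≤ n ∧ (∀ l ∈ c.2.2, g l.2.1 l.2.2.2 = true) ∧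
  FreeGroup.reduce (subst (Sum.elim (fun a => [(a, true)])
    (fun x => c.2.1.getD (varIdx c.1 x) [])) c.1 ++ consequence c.2.2) = []

theorem primrec_consequence : Primrec (consequence : _ → Word A) := by
  refine Primrec.list_flatMap Primrec.id ?_
  have h1 : Primrec fun x : List (Word A × Word A × Bool × ℕ) × (Word A × Word A × Bool × ℕ) =>
      x.2.1 := Primrec.fst.comp Primrec.snd
  have h2 : Primrec fun x : List (Word A × Word A × Bool × ℕ) × (Word A × Word A × Bool × ℕ) =>
      x.2.2.1 := Primrec.fst.comp (Primrec.snd.comp Primrec.snd)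
  have h3 : Primrec fun x : List (Word A × Word A × Bool × ℕ) × (Word A × Word A × Bool × ℕ) =>
      x.2.2.2.1 := Primrec.fst.comp (Primrec.snd.comp (Primrec.snd.comp Primrec.snd))
  exact (Primrec.list_append.comp h1 (Primrec.list_append.comp
    (Primrec.cond h3 h2 (primrec_invRev.comp h2)) (primrec_invRev.comp h1)) :)

theorem primrecPred_isCertificate (n : ℕ) {g : Word A → ℕ → Bool} (hg : Primrec₂ g) :
    PrimrecPred (IsCertificate (X := X) n g) := by
  classical
  have hv : Primrec fun c : Word (A ⊕ X) × List (Word A) × List (Word A × Word A × Bool × ℕ) =>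
    varList c.1 := primrec_varList.comp Primrec.fst
  refine PrimrecPred.and (PrimrecPred.and ?_ (PrimrecPred.and ?_ ?_)) (PrimrecPred.and ?_
    (PrimrecPred.and ?_ ?_))
  · have h1 : Primrec fun c : Word (A ⊕ X) × List (Word A) ×
        List (Word A × Word A × Bool × ℕ) => c.1 ++ c.1 :=
      Primrec.list_append.comp Primrec.fst Primrec.fst
    convert Primrec.eq.comp (primrec_reduce.comp h1) h1
  · exact Primrec.nat_lt.comp (Primrec.const 0) (Primrec.list_length.comp hv)
  · have h1 : PrimrecRel fun (x : X) (L : List X) => (L.filter fun y => y = x).length = 2 :=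
      Primrec.eq.comp (Primrec.list_length.comp ((PrimrecRel.listFilter Primrec.eq).comp
        Primrec.snd Primrec.fst)) (Primrec.const 2)
    convert h1.forall_mem_list.comp hv hv
  · exact Primrec.nat_le.comp (Primrec.list_length.comp hv) (Primrec.const n)
  · have h1 : PrimrecPred fun l : Word A × Word A × Bool × ℕ => g l.2.1 l.2.2.2 = true :=
      Primrec.eq.comp (hg.comp (Primrec.fst.comp Primrec.snd)
        (Primrec.snd.comp (Primrec.snd.comp Primrec.snd))) (Primrec.const true)
    exact h1.forall_mem_list.comp (Primrec.snd.comp Primrec.snd)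
  · have h1 : Primrec fun x : ((Word (A ⊕ X) × List (Word A) ×
        List (Word A × Word A × Bool × ℕ)) × (A ⊕ X)) × X =>
        x.1.1.2.1.getD (varIdx x.1.1.1 x.2) [] :=
      (Primrec.list_getD []).comp
        (Primrec.fst.comp (Primrec.snd.comp (Primrec.fst.comp Primrec.fst)))
        (primrec_varIdx.comp (Primrec.fst.comp (Primrec.fst.comp Primrec.fst)) Primrec.snd)
    have h2 : Primrec fun x : (Word (A ⊕ X) × List (Word A) ×
        List (Word A × Word A × Bool × ℕ)) × (A ⊕ X) =>
        (Sum.casesOn x.2 (fun a => [(a, true)]) (fun y => x.1.2.1.getD (varIdx x.1.1 y) []) :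
          Word A) :=
      Primrec.sumCasesOn Primrec.snd (Primrec.list_cons.comp (Primrec.snd.pair
        (Primrec.const true)) (Primrec.const [])).to₂ h1.to₂
    have h3 : Primrec₂ fun (c : Word (A ⊕ X) × List (Word A) ×
        List (Word A × Word A × Bool × ℕ)) (a : A ⊕ X) =>
        (Sum.elim (fun a => [(a, true)]) (fun x => c.2.1.getD (varIdx c.1 x) []) a : Word A) :=
      h2.of_eq fun x => by rcases x with ⟨_, a | b⟩ <;> rfl
    convert Primrec.eq.comp (primrec_reduce.comp (Primrec.list_append.comp
      (primrec_subst h3 Primrec.fst) (primrec_consequence.comp (Primrec.snd.comp Primrec.snd))))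
      (Primrec.const [])

variable {G : Type*} [Group G]

/-- A solution is written in words over the generators. The resulting word is trivial in `G` exactly
when a product of conjugates of defining words cancels it in the free group, which free reduction
verifies. -/
theorem exists_isCertificate_iff {n : ℕ} {gen : A → G} {R : Set (Word A)}
    (hR : IsPresentation gen R) {g : Word A → ℕ → Bool} (hg : ∀ r, r ∈ R ↔ ∃ k, g r k = true)
    {W : Word (A ⊕ X)} : (∃ V L, IsCertificate n g (W, V, L)) ↔
      IsQuadratic W ∧ xLength W ≤ n ∧ HasSolution gen W := by
  classical
  have hmem : ∀ w : Word A, wordEval gen w = 1 ↔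
      FreeGroup.mk w ∈ Subgroup.normalClosure (Set.range fun r : R => FreeGroup.mk r.1) := by
    intro w
    rw [wordEval, ← MonoidHom.mem_ker, hR.ker_eq, Set.image_eq_range]
  have heval : ∀ V : List (Word A), wordEval gen (subst (Sum.elim (fun a => [(a, true)])
      (fun x => V.getD (varIdx W x) [])) W) =
      wordEval (Sum.elim gen fun x => wordEval gen (V.getD (varIdx W x) [])) W := by
    intro V
    rw [wordEval_subst]
    congr 1
    ext1 (a | x)
    · simp [wordEval_cons]
    · rfl
  constructor
  · rintro ⟨V, L, h1, h2, h3, h4⟩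
    refine ⟨isQuadratic_iff.2 (by convert h1), by rwa [← length_varList], hasSolution_iff.2
      ⟨fun x => wordEval gen (V.getD (varIdx W x) []), ?_⟩⟩
    rw [← heval]
    have h5 : wordEval gen (subst (Sum.elim (fun a => [(a, true)])
        (fun x => V.getD (varIdx W x) [])) W ++ consequence L) = 1 := by
      rw [wordEval, ← FreeGroup.reduce.self, h4, ← FreeGroup.one_eq_mk, map_one]
    have h6 : wordEval gen (consequence L) = 1 := by
      rw [wordEval_consequence]
      refine List.prod_eq_one fun k hk => ?_
      obtain ⟨l, hl, rfl⟩ := List.mem_map.1 hk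
      have h7 : wordEval gen l.2.1 = 1 := (hmem _).2 (Subgroup.subset_normalClosure
        ⟨⟨l.2.1, (hg _).2 ⟨_, h3 l hl⟩⟩, rfl⟩)
      rw [h7]
      cases l.2.2.1 <;> simp
    rwa [wordEval_append, h6, mul_one] at h5
  · rintro ⟨h1, h2, h3⟩
    obtain ⟨y, hy⟩ := hasSolution_iff.1 h3
    have hsurj : ∀ b : G, ∃ w : Word A, wordEval gen w = b := by
      intro b
      obtain ⟨u, rfl⟩ := hR.surjective b
      exact ⟨u.toWord, by rw [wordEval, FreeGroup.mk_toWord]⟩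
    choose v hv using fun x => hsurj (y x)
    have h4 := heval ((varList W).map v)
    rw [wordEval_congr (g := Sum.elim gen y), hy, hmem] at h4
    · obtain ⟨L, hL⟩ := exists_list_of_mem_normalClosure _ (inv_mem h4)
      choose k hk using fun r : R => (hg r.1).1 r.2
      refine ⟨(varList W).map v, L.map fun l => (l.1.toWord, l.2.1.1, l.2.2, k l.2.1),
        by convert isQuadratic_iff.1 h1, by rwa [length_varList], ?_, ?_⟩
      · intro l hl
        obtain ⟨l, -, rfl⟩ := List.mem_map.1 hl
        exact hk _
      · rw [← FreeGroup.toWord_mk, FreeGroup.toWord_eq_nil_iff, ← FreeGroup.mul_mk,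
          mul_eq_one_iff_inv_eq, ← wordEval_of (consequence _), wordEval_consequence, ← hL,
          List.map_map]
        congr 1
        refine List.map_congr_left fun l _ => ?_
        simp only [Function.comp_apply, wordEval_of, FreeGroup.mk_toWord]
    · rintro ⟨a | x, ε⟩ ha
      · rfl
      · have hx : x ∈ vars W := mem_vars.2 ⟨_, ha, rfl⟩
        simp [varList_getElem?_varIdx hx, hv]

theorem exists_isEnumeration [Nonempty X] {n : ℕ} (hn : 2 ≤ n) {gen : A → G} {R : Set (Word A)}
    (hR : IsPresentation gen R) :
    ∃ e : ℕ → Word (A ⊕ X), IsEnumeration n gen e ∧ (REPred (fun w => w ∈ R) → Computable e) := by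
  classical
  obtain ⟨x⟩ := ‹Nonempty X›
  -- The equation `x² = 1`, solved by `x = 1` and of length `2 ≤ n`, is the filler for numbers that
  -- code no certificate.
  let W₀ : Word (A ⊕ X) := [(Sum.inr x, true), (Sum.inr x, true)]
  have hW₀ : IsQuadratic W₀ ∧ xLength W₀ ≤ n ∧ HasSolution gen W₀ :=
    ⟨isQuadratic_square x, hn,
      hasSolution_iff.2 ⟨fun _ => 1, by simp [W₀, wordEval_cons]⟩⟩
  by_cases hre : REPred fun w => w ∈ R
  · obtain ⟨g, hg, hgR⟩ := exists_stages hre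
    let f : Word (A ⊕ X) × List (Word A) × List (Word A × Word A × Bool × ℕ) → Word (A ⊕ X) :=
      fun c => if IsCertificate n g c then c.1 else W₀
    have hf : Primrec f :=
      Primrec.ite (primrecPred_isCertificate n hg) Primrec.fst (Primrec.const W₀)
    refine ⟨fun k => (Encodable.decode k).elim W₀ f, ?_, fun _ => ?_⟩
    · refine Set.Subset.antisymm ?_ fun W hW => ?_
      · rintro _ ⟨k, rfl⟩
        rcases h : (Encodable.decode k : Option (Word (A ⊕ X) × List (Word A) ×
          List (Word A × Word A × Bool × ℕ))) with _ | ⟨W, V, L⟩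
        · simp only [h, Option.elim_none]
          exact hW₀
        · simp only [h, Option.elim_some, f]
          split_ifs with hc
          · exact (exists_isCertificate_iff hR hgR).1 ⟨V, L, hc⟩
          · exact hW₀
      · obtain ⟨V, L, hc⟩ := (exists_isCertificate_iff hR hgR).2 hW
        refine ⟨Encodable.encode (W, V, L), ?_⟩
        simp only [Encodable.encodek, Option.elim_some, f, if_pos hc]
    · refine ((Primrec.option_casesOn Primrec.decode (Primrec.const W₀)
        (hf.comp Primrec.snd).to₂).of_eq fun k => ?_).to_comp
      cases (Encodable.decode k : Option (Word (A ⊕ X) × List (Word A) ×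
        List (Word A × Word A × Bool × ℕ))) <;> rfl
  -- Without recursive enumerability nothing about computability is claimed, and any enumeration of
  -- the countable set serves.
  · obtain ⟨e, he⟩ := (Set.to_countable {W : Word (A ⊕ X) |
      IsQuadratic W ∧ xLength W ≤ n ∧ HasSolution gen W}).exists_eq_range ⟨W₀, hW₀⟩
    exact ⟨e, he.symm, fun h => absurd h hre⟩

end Certificates

/-! ### Assembly -/

theorem exists_embedding_of_isEnumeration {A X G : Type*} [Primcodable A] [Primcodable X]
    [Group G] {n : ℕ} (hn : 2 ≤ n) {gen : A → G} {R : Set (Word A)} (hR : IsPresentation gen R)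
    {e : ℕ → Word (A ⊕ X)} (he : IsEnumeration n gen e) :
    ∃ (S : Set (Word (Fin 2))) (μ : G →* TwoGenGroup S),
      PreservesQuadratic X n gen μ ∧ HasShortSolutions 400 n gen e S μ ∧
      (Computable e →
        (REPred (fun w => w ∈ R) → REPred (fun w => w ∈ S)) ∧
        (ComputablePred (fun w => w ∈ R) →
          ComputablePred (fun w => w ∈ S) ∧ IsEffective gen S μ)) := by
  obtain ⟨μ, h1, h2, h3⟩ := exists_embedding hn hR he
  have hpos : ∀ p, 0 < xLength (e p) := fun p =>
    ((Set.ext_iff.1 he (e p)).1 ⟨p, rfl⟩).1.1.2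
  exact ⟨_, μ, h2, h3, fun hc => ⟨rePred_defWords n _ hc, fun hd =>
    ⟨computablePred_defWords (by omega) (by omega) hc hpos hd,
      _, (primrec_genWord _).to_comp, h1⟩⟩⟩

end QuadEmb

open QuadEmb in
theorem theorem2 :
    ∃ C : ℝ, 0 < C ∧
      ∀ (n : ℕ), 2 ≤ n →
      ∀ (A : Type*) [Primcodable A] (X : Type*) [Primcodable X] [Nonempty X]
        (G : Type*) [Group G] (gen : A → G) (R : Set (Word A)), IsPresentation gen R →
        (∀ e : ℕ → Word (A ⊕ X), IsEnumeration n gen e →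
          ∃ (S : Set (Word (Fin 2))) (μ : G →* TwoGenGroup S),
            PreservesQuadratic X n gen μ ∧ HasShortSolutions C n gen e S μ ∧
            (Computable e →
              (REPred (fun w => w ∈ R) → REPred (fun w => w ∈ S)) ∧
              (ComputablePred (fun w => w ∈ R) → DecidableQuadratic X n gen →
                ComputablePred (fun w => w ∈ S) ∧ IsEffective gen S μ))) ∧
        (∃ e : ℕ → Word (A ⊕ X), IsEnumeration n gen e ∧
          (REPred (fun w => w ∈ R) → Computable e) ∧
          ∃ (S : Set (Word (Fin 2))) (μ : G →* TwoGenGroup S),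
            PreservesQuadratic X n gen μ ∧ HasShortSolutions C n gen e S μ ∧
            (REPred (fun w => w ∈ R) → REPred (fun w => w ∈ S)) ∧
            (ComputablePred (fun w => w ∈ R) → DecidableQuadratic X n gen →
              ComputablePred (fun w => w ∈ S) ∧ IsEffective gen S μ)) := by
  refine ⟨400, by norm_num, fun n hn A _ X _ _ G _ gen R hR => ⟨fun e he => ?_, ?_⟩⟩
  · obtain ⟨S, μ, h1, h2, h3⟩ := exists_embedding_of_isEnumeration hn hR he
    exact ⟨S, μ, h1, h2, fun hc => ⟨(h3 hc).1, fun hd _ => (h3 hc).2 hd⟩⟩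
  · obtain ⟨e, he, hc⟩ := exists_isEnumeration (X := X) hn hR
    obtain ⟨S, μ, h1, h2, h3⟩ := exists_embedding_of_isEnumeration hn hR he
    exact ⟨e, he, hc, S, μ, h1, h2, fun hr => (h3 (hc hr)).1 hr,
      fun hd _ => (h3 (hc hd.to_re)).2 hd⟩
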